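/- Let $\Gamma$ be a compact connected metric graph: a finite connected graph with vertex set $V$ and non-empty edge set $E$, without loops or multiple edges, each edge ${\bf e}$ being oriented from an initial vertex ${\rm i}_{\bf e}$ to a terminal vertex ${\rm f}_{\bf e}$ and identified with an interval $[0,\ell_{\bf e}]$, $0<\ell_{\bf e}<\infty$. Put $\ell(\Gamma)=\sum_{\bf e}\ell_{\bf e}$; for measurable $A\subset\Gamma$ let $\ell(A)$ be the sum over the edges of the Lebesgue measure of the part of $A$ on that edge. A function $u$ on $\Gamma$ is a collection of functions $[u]_{\bf e}$ on $(0,\ell_{\bf e})$, $\int_\Gamma u\,dx=\sum_{\bf e}\int_0^{\ell_{\bf e}}[u]_{\bf e}\,dx$, and $u\in BV(\Gamma)$ means $[u]_{\bf e}\in BV(0,\ell_{\bf e})$ for every ${\bf e}$ (no continuity at the vertices is required). Let $X_K(\Gamma)$ be the set of all ${\bf z}$ with $[{\bf z}]_{\bf e}\in W^{1,2}(0,\ell_{\bf e})$ for every ${\bf e}$ that satisfy the Kirchhoff condition $$\sum_{{\bf e}:\,{\rm f}_{\bf e}={\bf v}}[{\bf z}]_{\bf e}(\ell_{\bf e})-\sum_{{\bf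 e}:\,{\rm i}_{\bf e}={\bf v}}[{\bf z}]_{\bf e}(0)=0\qquad\text{for all }{\bf v}\in V .$$ Define $$TV_\Gamma(u)=\sup\Big\{\Big|\int_\Gamma u\,{\bf z}'\,dx\Big| : {\bf z}\in X_K(\Gamma),\ \|{\bf z}\|_{L^\infty(\Gamma)}\le 1\Big\}\in[0,\infty],\qquad {\rm Per}_\Gamma(A)=TV_\Gamma(\chi_A),$$ $$h(\Gamma)=\inf\Big\{\frac{{\rm Per}_\Gamma(D)}{\min\{\ell(D),\ell(\Gamma\setminus D)\}} : D\subset\Gamma \text{ measurable},\ 0<\ell(D)<\ell(\Gamma)\Big\},$$ $$\lambda_1(\Gamma)=\inf\{TV_\Gamma(u) : u\in\Pi(\Gamma)\},\qquad \Pi(\Gamma)=\{u\in BV(\Gamma) : \|u\|_{L^1(\Gamma)}=1,\ 0\in{\rm med}_\ell(u)\},$$ where $0\in{\rm med}_\ell(u)$ means $\ell(\{u<0\})\le\frac12\ell(\Gamma)$ and $\ell(\{u>0\})\le\frac12\ell(\Gamma)$. Let $A\subset\Gamma$ be measurable with $\ell(A)=\frac12\ell(\Gamma)$, and let $u=\frac1{\ell(\Gamma)}\big(\chi_A-\chi_{\Gamma\setminus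 A}\big)$. Then $$h(\Gamma)=\frac{{\rm Per}_\Gamma(A)}{\ell(A)}\iff u\in\Pi(\Gamma)\ \text{ and }\ TV_\Gamma(u)=\lambda_1(\Gamma),$$ that is, if and only if $u$ is a minimizer of the variational problem defining $\lambda_1(\Gamma)$. -/

import Mathlib

open MeasureTheory Set
open scoped ENNReal ContDiff

noncomputable section

/-- A connected metric graph with vertex set `V` and edge set `E`, all of whose edges have finite
length, without loops and without multiple edges. Each edge is oriented from its initial vertex
`init e` to its terminal vertex `term e` and is identified with `[0, len e]`. (It is compact when
`V` and `E` are finite.) -/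
structure MetricGraph (V E : Type*) where
  init : E → V
  term : E → V
  len : E → ℝ
  len_pos : ∀ e, 0 < len e
  no_loops : ∀ e, init e ≠ term e
  no_multiple_edges : ∀ e e', s(init e, term e) = s(init e', term e') → e = e'
  connected : (SimpleGraph.fromRel fun v w => ∃ e, init e = v ∧ term e = w).Connected

namespace MetricGraph

/-- A smooth function with compact support in `(a, b)`. -/
def IsTestFunction (a b : ℝ) (φ : ℝ → ℝ) : Prop :=
  ContDiff ℝ ∞ φ ∧ HasCompactSupport φ ∧ tsupport φ ⊆ Ioo a b

/-- `u ∈ BV(a, b)`: `u` is integrable and its distributional derivative is a finite signed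
measure, written as a difference `μ - ν` of finite positive Borel measures. -/
def MemBVInterval (a b : ℝ) (u : ℝ → ℝ) : Prop :=
  IntegrableOn u (Ioo a b) ∧
    ∃ μ ν : Measure ℝ, IsFiniteMeasure μ ∧ IsFiniteMeasure ν ∧
      ∀ φ, IsTestFunction a b φ →
        ∫ x in Ioo a b, u x * deriv φ x = -(∫ x in Ioo a b, φ x ∂μ - ∫ x in Ioo a b, φ x ∂ν)

/-- `z` is the continuous representative on `[a, b]` of an element of `W^{1,2}(a, b)`, and `z'` is
its weak derivative. -/
def IsSobolevPair (a b : ℝ) (z z' : ℝ → ℝ) : Prop :=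
  ContinuousOn z (Icc a b) ∧
    MemLp z 2 (volume.restrict (Ioo a b)) ∧ MemLp z' 2 (volume.restrict (Ioo a b)) ∧
      ∀ φ, IsTestFunction a b φ →
        ∫ x in Ioo a b, z x * deriv φ x = -∫ x in Ioo a b, z' x * φ x

variable {V E : Type*} (G : MetricGraph V E)

/-- The points of the graph: its vertices and the interior points of its edges. -/
def Point : Type _ := V ⊕ (Σ e : E, Ioo (0 : ℝ) (G.len e))

open Classical in
/-- The point of the edge `e` with coordinate `x ∈ [0, len e]` (extended constantly to `ℝ`). -/
def point (e : E) (x : ℝ) : G.Point :=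
  if h : x ∈ Ioo (0 : ℝ) (G.len e) then Sum.inr ⟨e, ⟨x, h⟩⟩
  else if x ≤ 0 then Sum.inl (G.init e) else Sum.inl (G.term e)

/-- The set `c_e(A ∩ e) ⊆ [0, len e]` of the coordinates of the points of `A` on the edge `e`. -/
def coordSet (A : Set G.Point) (e : E) : Set ℝ :=
  {x | x ∈ Icc 0 (G.len e) ∧ G.point e x ∈ A}

/-- `A` is (Lebesgue) measurable on every edge. -/
def IsMeasurable (A : Set G.Point) : Prop :=
  ∀ e, NullMeasurableSet (G.coordSet A e) volume

/-- A real function on the graph is a collection of functions `u e` on `(0, len e)`; the values of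
`u e` outside of this interval play no role. -/
def Fun (_ : MetricGraph V E) : Type _ := E → ℝ → ℝ

/-- The characteristic function of a set. -/
def char (A : Set G.Point) : G.Fun :=
  fun e => (G.coordSet A e).indicator fun _ => 1

/-- The set `{u > t}`. -/
def superlevel (u : G.Fun) (t : ℝ) : Set G.Point :=
  {p | ∃ e, ∃ x ∈ Ioo (0 : ℝ) (G.len e), p = G.point e x ∧ t < u e x}

/-- The set `{u < t}`. -/
def sublevel (u : G.Fun) (t : ℝ) : Set G.Point :=
  {p | ∃ e, ∃ x ∈ Ioo (0 : ℝ) (G.len e), p = G.point e x ∧ u e x < t}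

/-- `u ∈ BV(Γ)`. -/
def MemBV (u : G.Fun) : Prop :=
  ∀ e, MemBVInterval 0 (G.len e) (u e)

open Classical in
/-- The outward value at the vertex `v` of `z` on an edge `e` incident to `v`. -/
def outward (z : G.Fun) (e : E) (v : V) : ℝ :=
  if v = G.term e then z e (G.len e) else -z e 0

variable [Fintype E]

/-- The total length `ℓ(Γ)`. -/
def totalLength : ℝ := ∑ e, G.len e

/-- The length `ℓ(A)` of a set `A ⊆ Γ`. -/
def length (A : Set G.Point) : ℝ≥0∞ := ∑ e, volume (G.coordSet A e)

theorem length_univ : G.length univ = ENNReal.ofReal G.totalLength := by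
  unfold length totalLength
  rw [ENNReal.ofReal_sum_of_nonneg fun e _ => (G.len_pos e).le]
  refine Finset.sum_congr rfl fun e _ => ?_
  have h : G.coordSet univ e = Icc 0 (G.len e) := by
    ext x
    simp [coordSet]
  rw [h, Real.volume_Icc, sub_zero]

open Classical in
/-- The edges incident to `v`. -/
def incidentEdges (v : V) : Finset E :=
  Finset.univ.filter fun e => G.init e = v ∨ G.term e = v

/-- `z ∈ X_K(Γ)` with weak derivative `z'`: `z` is in `W^{1,2}` on every edge and satisfies the
Kirchhoff condition at every vertex. -/
def MemXK (z z' : G.Fun) : Prop :=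
  (∀ e, IsSobolevPair 0 (G.len e) (z e) (z' e)) ∧
    ∀ v, ∑ e ∈ G.incidentEdges v, G.outward z e v = 0

/-- The total variation `TV_Γ(u)`: the supremum of `|∫_Γ u z'|` over all `z ∈ X_K(Γ)` with
`‖z‖_∞ ≤ 1`. -/
def TV (u : G.Fun) : ℝ≥0∞ :=
  ⨆ (z : G.Fun) (z' : G.Fun) (_ : G.MemXK z z')
    (_ : ∀ e, eLpNorm (z e) ∞ (volume.restrict (Ioo 0 (G.len e))) ≤ 1),
    ENNReal.ofReal |∑ e, ∫ x in Ioo 0 (G.len e), u e x * z' e x|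

/-- The perimeter `Per_Γ(A)`. -/
def Per (A : Set G.Point) : ℝ≥0∞ := G.TV (G.char A)

/-- The Cheeger constant `h(Γ)`. -/
def cheeger : ℝ≥0∞ :=
  ⨅ (D : Set G.Point) (_ : G.IsMeasurable D) (_ : 0 < G.length D)
    (_ : G.length D < ENNReal.ofReal G.totalLength), G.Per D / min (G.length D) (G.length Dᶜ)

/-- The norm of `L¹(Γ)`. -/
def normL1 (u : G.Fun) : ℝ≥0∞ :=
  ∑ e, eLpNorm (u e) 1 (volume.restrict (Ioo 0 (G.len e)))

/-- `m` is a median of `u`. -/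
def IsMedian (u : G.Fun) (m : ℝ) : Prop :=
  G.length (G.sublevel u m) ≤ ENNReal.ofReal (G.totalLength / 2) ∧
    G.length (G.superlevel u m) ≤ ENNReal.ofReal (G.totalLength / 2)

/-- The admissible class `Π(Γ)`. -/
def admissible : Set G.Fun :=
  {u | G.MemBV u ∧ G.normL1 u = 1 ∧ G.IsMedian u 0}

/-- `λ₁(Γ)`, the infimum of the total variation over `Π(Γ)`. -/
def lambda1 : ℝ≥0∞ := ⨅ u ∈ G.admissible, G.TV u

/-- `u` is a minimizer of the variational problem for `λ₁(Γ)`. -/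
def IsMinimizer (u : G.Fun) : Prop :=
  u ∈ G.admissible ∧ G.TV u = G.lambda1

/-- The function `(χ_A - χ_{Γ ∖ A}) / ℓ(Γ)`. -/
def cutFun (A : Set G.Point) : G.Fun :=
  fun e x => 1 / G.totalLength * (G.char A e x - G.char Aᶜ e x)

end MetricGraph

end

/-!
Both implications follow from `λ₁(Γ) = h(Γ)`, because `TV(u) = Per(A) / ℓ(A)` for the function `u`
of the theorem.

The inequality `λ₁ ≤ h` is tested on normalised characteristic functions. An integrable function of
finite total variation is in `BV`: fields supported inside a single edge satisfy the Kirchhoff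
condition trivially, so they already bound the variation on that edge.

The inequality `h ≤ λ₁` is a coarea argument. For a function that is constant on small cells, a
single Kirchhoff field is optimal for all superlevel sets at once: next to a jump in the interior of
an edge it is the sign of the jump, and at a vertex it is balanced around a median of the incident
values. Integrating the isoperimetric inequality for the superlevel sets over all levels gives
`h * ‖u - c‖₁ ≤ TV(u)`, where `c` is a median of `u`. This field can be taken affine on every cell,
so it pairs with a general `u` as it does with the function of the cell means of `u`, and these
converge to `u` in `L¹` as the cells shrink.
-/

section WeightedMedian

variable {ι : Type*} {s : Finset ι} {w a d : ι → ℝ} {κ : ℝ}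

theorem exists_weighted_median (hw : ∀ i ∈ s, 0 ≤ w i) (a : ι → ℝ) :
    ∃ c, ∑ i ∈ s with c < a i, w i ≤ ∑ i ∈ s with a i ≤ c, w i ∧
      ∑ i ∈ s with a i < c, w i ≤ ∑ i ∈ s with c ≤ a i, w i := by
  rcases s.eq_empty_or_nonempty with rfl | hs
  · exact ⟨0, by simp⟩
  have hnonneg : ∀ (p : ι → Prop) [DecidablePred p], 0 ≤ ∑ i ∈ s with p i, w i := fun p _ =>
    Finset.sum_nonneg fun i hi => hw i (Finset.mem_of_mem_filter i hi)
  let T := s.filter fun i => ∑ j ∈ s with a j < a i, w j ≤ ∑ j ∈ s with a i ≤ a j, w j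
  obtain ⟨i₀, hi₀, hmin⟩ := s.exists_min_image a hs
  have hT : i₀ ∈ T := by
    refine Finset.mem_filter.2 ⟨hi₀, ?_⟩
    rw [Finset.filter_false_of_mem fun j hj => (hmin j hj).not_gt, Finset.sum_empty]
    exact hnonneg _
  obtain ⟨i, hi, hmax⟩ := T.exists_max_image a ⟨i₀, hT⟩
  refine ⟨a i, ?_, (Finset.mem_filter.1 hi).2⟩
  by_contra! hlt
  have hne : (s.filter fun j => a i < a j).Nonempty := by
    rw [Finset.nonempty_iff_ne_empty]
    intro he
    rw [he, Finset.sum_empty] at hlt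
    exact (hnonneg _).not_gt hlt
  obtain ⟨i', hi', hmin'⟩ := Finset.exists_min_image _ a hne
  obtain ⟨his', hii'⟩ := Finset.mem_filter.1 hi'
  have habove : ∀ j ∈ s, a i' ≤ a j ↔ a i < a j := fun j hj =>
    ⟨hii'.trans_le, fun h => hmin' j (Finset.mem_filter.2 ⟨hj, h⟩)⟩
  refine (hmax i' (Finset.mem_filter.2 ⟨his', ?_⟩)).not_gt hii'
  rw [Finset.filter_congr habove, Finset.filter_congr fun j hj =>
    not_le.symm.trans ((habove j hj).not.trans not_lt)]
  exact hlt.le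

theorem min_sum_filter_eq_of_weighted_median (hw : ∀ i ∈ s, 0 ≤ w i) {c : ℝ}
    (hgt : ∑ i ∈ s with c < a i, w i ≤ ∑ i ∈ s with a i ≤ c, w i)
    (hlt : ∑ i ∈ s with a i < c, w i ≤ ∑ i ∈ s with c ≤ a i, w i) (t : ℝ) :
    min (∑ i ∈ s with t < a i, w i) (∑ i ∈ s with a i ≤ t, w i) =
      ∑ i ∈ s, w i * ((Ico c (a i)).indicator 1 t + (Ico (a i) c).indicator 1 t) := by
  have hsub : ∀ {p q : ι → Prop} [DecidablePred p] [DecidablePred q], (∀ i, p i → q i) →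
      ∑ i ∈ s with p i, w i ≤ ∑ i ∈ s with q i, w i := fun h =>
    Finset.sum_le_sum_of_subset_of_nonneg (Finset.monotone_filter_right s fun i _ => h i)
      fun i hi _ => hw i (Finset.mem_of_mem_filter i hi)
  rcases le_or_gt c t with hct | htc
  · rw [min_eq_left ((hsub fun i => hct.trans_lt).trans (hgt.trans (hsub fun i h => h.trans hct))),
      Finset.sum_filter]
    refine Finset.sum_congr rfl fun i _ => ?_
    simp [indicator, hct, hct.not_gt]
  · rw [min_eq_right ((hsub fun i h => h.trans_lt htc).trans
      (hlt.trans (hsub fun i => htc.trans_le))), Finset.sum_filter]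
    refine Finset.sum_congr rfl fun i _ => ?_
    simp [indicator, htc, htc.not_ge]

theorem integrable_indicator_Ico_one (x y : ℝ) : Integrable ((Ico x y).indicator (1 : ℝ → ℝ)) :=
  (integrable_indicator_iff measurableSet_Ico).2 (integrableOn_const (by simp))

theorem integral_indicator_Ico_one (x y : ℝ) :
    ∫ t, (Ico x y).indicator (1 : ℝ → ℝ) t = max (y - x) 0 := by
  rw [integral_indicator_one measurableSet_Ico, Measure.real, Real.volume_Ico,
    ENNReal.toReal_ofReal']

theorem sum_filter_lt_eq_sum_mul_indicator (hd : ∑ i ∈ s, d i = 0) (a : ι → ℝ) (c t : ℝ) :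
    ∑ i ∈ s with t < a i, d i =
      ∑ i ∈ s, d i * ((Ico c (a i)).indicator 1 t - (Ico (a i) c).indicator 1 t) := by
  calc ∑ i ∈ s with t < a i, d i
      = ∑ i ∈ s, ((if t < a i then d i else 0) - d i * if t < c then 1 else 0) := by
        rw [Finset.sum_sub_distrib, ← Finset.sum_mul, hd, zero_mul, sub_zero, Finset.sum_filter]
    _ = _ := Finset.sum_congr rfl fun i _ => by
        by_cases hta : t < a i <;> by_cases htc : t < c <;>
          simp [indicator, hta, htc, not_lt.1, not_le.2]

theorem exists_mul_sum_abs_sub_le (hw : ∀ i ∈ s, 0 ≤ w i) (hd : ∑ i ∈ s, d i = 0)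
    (h : ∀ t, κ * min (∑ i ∈ s with t < a i, w i) (∑ i ∈ s with a i ≤ t, w i) ≤
      ∑ i ∈ s with t < a i, d i) :
    ∃ c, κ * ∑ i ∈ s, w i * |a i - c| ≤ ∑ i ∈ s, d i * a i := by
  obtain ⟨c, hgt, hlt⟩ := exists_weighted_median hw a
  have hInt := integrable_indicator_Ico_one
  have hadd : ∀ i, Integrable fun t => w i *
      ((Ico c (a i)).indicator (1 : ℝ → ℝ) t + (Ico (a i) c).indicator 1 t) :=
    fun i => ((hInt _ _).add (hInt _ _)).const_mul _
  have hsub : ∀ i, Integrable fun t => d i *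
      ((Ico c (a i)).indicator (1 : ℝ → ℝ) t - (Ico (a i) c).indicator 1 t) :=
    fun i => ((hInt _ _).sub (hInt _ _)).const_mul _
  have hle : ∫ t, κ * ∑ i ∈ s, w i * ((Ico c (a i)).indicator 1 t + (Ico (a i) c).indicator 1 t) ≤
      ∫ t, ∑ i ∈ s, d i * ((Ico c (a i)).indicator 1 t - (Ico (a i) c).indicator 1 t) := by
    refine integral_mono ((integrable_finsetSum _ fun i _ => hadd i).const_mul _)
      (integrable_finsetSum _ fun i _ => hsub i) fun t => ?_
    simpa only [min_sum_filter_eq_of_weighted_median hw hgt hlt,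
      sum_filter_lt_eq_sum_mul_indicator hd a c] using h t
  rw [integral_const_mul, integral_finsetSum _ fun i _ => hadd i,
    integral_finsetSum _ fun i _ => hsub i] at hle
  simp only [integral_const_mul, integral_add (hInt _ _) (hInt _ _),
    integral_sub (hInt _ _) (hInt _ _), integral_indicator_Ico_one] at hle
  have hdc : ∑ i ∈ s, d i * (a i - c) = ∑ i ∈ s, d i * a i := by
    simp only [mul_sub, Finset.sum_sub_distrib, ← Finset.sum_mul, hd, zero_mul, sub_zero]
  refine ⟨c, hdc ▸ ?_⟩
  convert hle using 3 with i _ i _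
  · rcases le_total c (a i) with hc | hc
    · rw [abs_of_nonneg (sub_nonneg.2 hc), max_eq_left (sub_nonneg.2 hc),
        max_eq_right (sub_nonpos.2 hc), add_zero]
    · rw [abs_of_nonpos (sub_nonpos.2 hc), max_eq_right (sub_nonpos.2 hc),
        max_eq_left (sub_nonneg.2 hc), zero_add, neg_sub]
  · rw [← neg_sub (a i) c, max_zero_sub_eq_self]

end WeightedMedian

section BalancedSign

theorem exists_balanced_sign {ι : Type*} (s : Finset ι) (b : ι → ℝ) :
    ∃ o : ι → ℝ, (∀ i, |o i| ≤ 1) ∧ ∑ i ∈ s, o i = 0 ∧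
      ∀ t, (∀ i, t < b i → o i = 1) ∨ ∀ i, b i ≤ t → o i = -1 := by
  obtain ⟨m, hgt, hlt⟩ := exists_weighted_median (w := fun _ => 1) (s := s)
    (fun _ _ => zero_le_one) b
  set p : ℝ := ∑ i ∈ s with m < b i, 1 with hp
  set q : ℝ := ∑ i ∈ s with b i < m, 1 with hq
  let r : ℝ := ∑ i ∈ s with b i = m, 1
  have hle : ∑ i ∈ s with b i ≤ m, (1 : ℝ) = q + r := by
    simp only [hq, r, Finset.sum_filter, ← Finset.sum_add_distrib]
    exact Finset.sum_congr rfl fun i _ => by grind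
  have hge : ∑ i ∈ s with m ≤ b i, (1 : ℝ) = p + r := by
    simp only [hp, r, Finset.sum_filter, ← Finset.sum_add_distrib]
    exact Finset.sum_congr rfl fun i _ => by grind
  rw [hle] at hgt
  rw [hge] at hlt
  have hr : 0 ≤ r := by linarith
  obtain ⟨τ, hτ, hrτ⟩ : ∃ τ, |τ| ≤ 1 ∧ r * τ = q - p := by
    refine ⟨(q - p) / r, ?_, mul_div_cancel_of_imp' fun h0 => by linarith⟩
    rw [abs_div, abs_of_nonneg hr]
    exact div_le_one_of_le₀ (abs_le.2 ⟨by linarith, by linarith⟩) hr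
  let o : ι → ℝ := fun i => if m < b i then 1 else if b i < m then -1 else τ
  refine ⟨o, fun i => ?_, ?_, fun t => ?_⟩
  · dsimp only [o]
    split_ifs <;> simp [hτ]
  · have ho : ∑ i ∈ s, o i = p - q + r * τ := by
      simp only [hp, hq, r, Finset.sum_filter, Finset.sum_mul, ← Finset.sum_add_distrib,
        ← Finset.sum_sub_distrib]
      refine Finset.sum_congr rfl fun i _ => ?_
      rcases lt_trichotomy (b i) m with h | h | h
      · simp [o, h, h.not_gt, h.ne]
      · simp [o, h]
      · simp [o, h, h.not_gt, h.ne']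
    rw [ho, hrτ, sub_add_sub_cancel, sub_self]
  · rcases le_or_gt m t with hmt | htm
    · exact .inl fun i hi => if_pos (hmt.trans_lt hi)
    · exact .inr fun i hi => (if_neg (hi.trans htm.le).not_gt).trans (if_pos (hi.trans_lt htm))

theorem sum_filter_lt_le_of_balanced_sign {ι : Type*} {s : Finset ι} {b o o' : ι → ℝ} {t : ℝ}
    (hsign : (∀ i ∈ s, t < b i → o i = 1) ∨ ∀ i ∈ s, b i ≤ t → o i = -1)
    (ho : ∑ i ∈ s, o i = 0) (ho' : ∑ i ∈ s, o' i = 0) (hle : ∀ i ∈ s, |o' i| ≤ 1) :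
    ∑ i ∈ s with t < b i, o' i ≤ ∑ i ∈ s with t < b i, o i := by
  rcases hsign with hsign | hsign
  · refine Finset.sum_le_sum fun i hi => ?_
    obtain ⟨his, hi⟩ := Finset.mem_filter.1 hi
    exact (hsign i his hi).symm ▸ (abs_le.1 (hle i his)).2
  · have hbelow : ∑ i ∈ s with ¬t < b i, o i ≤ ∑ i ∈ s with ¬t < b i, o' i := by
      refine Finset.sum_le_sum fun i hi => ?_
      obtain ⟨his, hi⟩ := Finset.mem_filter.1 hi
      exact (hsign i his (not_lt.1 hi)).symm ▸ (abs_le.1 (hle i his)).1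
    rw [← Finset.sum_filter_add_sum_filter_not s (fun i => t < b i)] at ho ho'
    linarith

theorem exists_balanced_maximal {H N : Type*} [Fintype H] [DecidableEq N] (node : H → N)
    (b : H → ℝ) :
    ∃ o : H → ℝ, (∀ h, |o h| ≤ 1) ∧ (∀ v, ∑ h with node h = v, o h = 0) ∧
      ∀ o' : H → ℝ, (∀ h, |o' h| ≤ 1) → (∀ v, ∑ h with node h = v, o' h = 0) →
        ∀ t, ∑ h with t < b h, o' h ≤ ∑ h with t < b h, o h := by
  choose o hle hsum hsign using fun v => exists_balanced_sign {h | node h = v} b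
  have hsum' : ∀ v, ∑ h with node h = v, o (node h) h = 0 := fun v => by
    rw [← hsum v]
    exact Finset.sum_congr rfl fun h hh => congrArg (o · h) (Finset.mem_filter.1 hh).2
  have hfiber : ∀ (f : H → ℝ) t, ∑ h with t < b h, f h =
      ∑ v ∈ Finset.univ.image node, ∑ h ∈ {h | node h = v} with t < b h, f h := fun f t => by
    rw [← Finset.sum_fiberwise_of_maps_to (g := node) (t := Finset.univ.image node)
      fun h _ => Finset.mem_image_of_mem node (Finset.mem_univ h)]
    exact Finset.sum_congr rfl fun v _ => by rw [Finset.filter_comm]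
  refine ⟨fun h => o (node h) h, fun h => hle _ h, hsum', fun o' hle' ho' t => ?_⟩
  rw [hfiber, hfiber]
  refine Finset.sum_le_sum fun v _ => sum_filter_lt_le_of_balanced_sign
    ((hsign v t).imp (fun hs h hh hb => ?_) fun hs h hh hb => ?_) (hsum' v) (ho' v)
    fun h _ => hle' h
  all_goals rw [(Finset.mem_filter.1 hh).2]; exact hs h hb

end BalancedSign

theorem mul_ite_sub_ite_le_sign_mul {y : ℝ} (hy : |y| ≤ 1) (t x₁ x₂ : ℝ) :
    y * ((if t < x₁ then 1 else 0) - if t < x₂ then 1 else 0) ≤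
      SignType.sign (x₁ - x₂) * ((if t < x₁ then 1 else 0) - if t < x₂ then 1 else 0) := by
  obtain ⟨hy₁, hy₂⟩ := abs_le.1 hy
  split_ifs with h₁ h₂ h₂
  · simp
  · rw [sign_pos (by linarith)]
    simpa using hy₂
  · rw [sign_neg (by linarith)]
    simp only [SignType.coe_neg, SignType.coe_one]
    linarith
  · simp

theorem abs_coe_sign_le_one (x : ℝ) : |(SignType.sign x : ℝ)| ≤ 1 := by
  rcases SignType.sign x with _ | _ | _ <;> simp

theorem exists_uniformContinuous_integral_abs_sub_le {s : Set ℝ} (hs : MeasurableSet s) {f : ℝ → ℝ}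
    (hf : IntegrableOn f s) {ε : ℝ} (hε : 0 < ε) :
    ∃ g : ℝ → ℝ, UniformContinuous g ∧ Integrable g ∧ ∫ x in s, |f x - g x| ≤ ε := by
  have hf' := (integrable_indicator_iff hs).2 hf
  obtain ⟨g, hsupp, hle, hg, hgi⟩ := hf'.exists_hasCompactSupport_integral_sub_le hε
  refine ⟨g, hsupp.uniformContinuous_of_continuous hg, hgi, le_trans ?_ hle⟩
  calc ∫ x in s, |f x - g x|
      = ∫ x in s, ‖s.indicator f x - g x‖ :=
        setIntegral_congr_fun hs fun x hx => by rw [indicator_of_mem hx, Real.norm_eq_abs]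
    _ ≤ _ := setIntegral_le_integral (hf'.sub hgi).norm (.of_forall fun x => norm_nonneg _)

namespace MetricGraph

section Interval

variable {a b : ℝ} {f φ ψ g w z z' : ℝ → ℝ}

theorem integrableOn_Ioo_of_continuousOn (hf : ContinuousOn f (Icc a b)) :
    IntegrableOn f (Ioo a b) :=
  hf.integrableOn_Icc.mono_set Ioo_subset_Icc_self

theorem memLp_Ioo_of_continuousOn (hf : ContinuousOn f (Icc a b)) (p : ℝ≥0∞) :
    MemLp f p (volume.restrict (Ioo a b)) := by
  obtain ⟨C, hC⟩ := isCompact_Icc.exists_bound_of_continuousOn hf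
  exact MemLp.of_bound ((hf.mono Ioo_subset_Icc_self).aestronglyMeasurable measurableSet_Ioo) C
    ((ae_restrict_mem measurableSet_Ioo).mono fun x hx => hC x (Ioo_subset_Icc_self hx))

theorem integrableOn_Ioo_mul (hg : IntegrableOn g (Ioo a b)) (hf : ContinuousOn f (Icc a b)) :
    IntegrableOn (fun x => g x * f x) (Ioo a b) := by
  obtain ⟨C, hC⟩ := isCompact_Icc.exists_bound_of_continuousOn hf
  exact Integrable.mul_bdd (c := C) hg
    ((hf.mono Ioo_subset_Icc_self).aestronglyMeasurable measurableSet_Ioo)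
    ((ae_restrict_mem measurableSet_Ioo).mono fun x hx => hC x (Ioo_subset_Icc_self hx))

theorem continuousOn_integral_Icc (hab : a ≤ b) (hg : IntegrableOn g (Ioo a b)) :
    ContinuousOn (fun x => ∫ t in a..x, g t) (Icc a b) := by
  have h := intervalIntegral.continuousOn_primitive_interval (f := g) (μ := volume) (a := a)
    (b := b) (by rwa [uIcc_of_le hab, integrableOn_Icc_iff_integrableOn_Ioo])
  rwa [uIcc_of_le hab] at h

namespace IsTestFunction

theorem eq_zero_of_notMem (hφ : IsTestFunction a b φ) {x : ℝ} (hx : x ∉ Ioo a b) : φ x = 0 :=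
  image_eq_zero_of_notMem_tsupport fun h => hx (hφ.2.2 h)

theorem apply_left (hφ : IsTestFunction a b φ) : φ a = 0 :=
  hφ.eq_zero_of_notMem fun h => h.1.false

theorem apply_right (hφ : IsTestFunction a b φ) : φ b = 0 :=
  hφ.eq_zero_of_notMem fun h => h.2.false

theorem continuous (hφ : IsTestFunction a b φ) : Continuous φ := hφ.1.continuous

theorem differentiable (hφ : IsTestFunction a b φ) : Differentiable ℝ φ :=
  hφ.1.differentiable (by simp)

theorem continuous_deriv (hφ : IsTestFunction a b φ) : Continuous (deriv φ) :=
  hφ.1.continuous_deriv (by simp)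

theorem integrable (hφ : IsTestFunction a b φ) : Integrable φ :=
  hφ.continuous.integrable_of_hasCompactSupport hφ.2.1

theorem setIntegral_eq_integral (hφ : IsTestFunction a b φ) : ∫ x in Ioo a b, φ x = ∫ x, φ x :=
  setIntegral_eq_integral_of_forall_compl_eq_zero fun _ hx => hφ.eq_zero_of_notMem hx

theorem intervalIntegral_deriv (hφ : IsTestFunction a b φ) (x y : ℝ) :
    ∫ t in x..y, deriv φ t = φ y - φ x :=
  intervalIntegral.integral_deriv_eq_sub (fun t _ => hφ.differentiable t)
    (hφ.continuous_deriv.intervalIntegrable _ _)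

theorem setIntegral_deriv (hφ : IsTestFunction a b φ) (hab : a ≤ b) :
    ∫ x in Ioo a b, deriv φ x = 0 := by
  rw [← integral_Ioc_eq_integral_Ioo, ← intervalIntegral.integral_of_le hab,
    hφ.intervalIntegral_deriv, hφ.apply_right, hφ.apply_left, sub_zero]

theorem sub_const_mul (hφ : IsTestFunction a b φ) (hψ : IsTestFunction a b ψ) (c : ℝ) :
    IsTestFunction a b fun x => φ x - c * ψ x :=
  ⟨hφ.1.sub (contDiff_const.mul hψ.1), hφ.2.1.sub hψ.2.1.mul_left,
    (tsupport_sub φ _).trans (union_subset hφ.2.2 (tsupport_mul_subset_right.trans hψ.2.2))⟩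

theorem exists_eq_zero_off_Icc (hφ : IsTestFunction a b φ) :
    ∃ c d, a < c ∧ d < b ∧ ∀ x ∉ Icc c d, φ x = 0 := by
  rcases (tsupport φ).eq_empty_or_nonempty with he | hne
  · exact ⟨a + 1, b - 1, by linarith, by linarith, fun x _ =>
      image_eq_zero_of_notMem_tsupport (he ▸ notMem_empty x)⟩
  · obtain ⟨c, hc⟩ := hφ.2.1.isCompact.exists_isLeast hne
    obtain ⟨d, hd⟩ := hφ.2.1.isCompact.exists_isGreatest hne
    exact ⟨c, d, (hφ.2.2 hc.1).1, (hφ.2.2 hd.1).2, fun x hx =>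
      image_eq_zero_of_notMem_tsupport fun h => hx ⟨hc.2 h, hd.2 h⟩⟩

theorem hasDerivAt_integral_Iic (hψ : IsTestFunction a b ψ) (x : ℝ) :
    HasDerivAt (fun x => ∫ t in Iic x, ψ t) (ψ x) x := by
  have h : (fun x => ∫ t in Iic x, ψ t) = fun x => (∫ t in Iic 0, ψ t) + ∫ t in 0..x, ψ t :=
    funext fun x => by
      rw [← intervalIntegral.integral_Iic_sub_Iic hψ.integrable.integrableOn
        hψ.integrable.integrableOn, add_sub_cancel]
  exact h ▸ (hψ.continuous.integral_hasStrictDerivAt 0 x).hasDerivAt.const_add _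

theorem integral_Iic (hψ : IsTestFunction a b ψ) (h0 : ∫ x, ψ x = 0) :
    IsTestFunction a b fun x => ∫ t in Iic x, ψ t := by
  obtain ⟨c, d, hac, hdb, hψ0⟩ := hψ.exists_eq_zero_off_Icc
  have hzero : ∀ x ∉ Icc c d, ∫ t in Iic x, ψ t = 0 := fun x hx => by
    rcases lt_or_ge x c with hxc | hcx
    · exact setIntegral_eq_zero_of_forall_eq_zero fun t ht =>
        hψ0 t fun h => (h.1.trans ht).not_gt hxc
    · have hdx : d < x := not_le.1 fun h => hx ⟨hcx, h⟩
      rw [setIntegral_eq_integral_of_forall_compl_eq_zero, h0]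
      exact fun t ht => hψ0 t fun h => ht (h.2.trans hdx.le)
  have hts : tsupport (fun x => ∫ t in Iic x, ψ t) ⊆ Icc c d :=
    closure_minimal (fun x hx => by_contra fun h => hx (hzero x h)) isClosed_Icc
  refine ⟨contDiff_infty_iff_deriv.2 ⟨fun x => (hψ.hasDerivAt_integral_Iic x).differentiableAt, ?_⟩,
    isCompact_Icc.of_isClosed_subset (isClosed_tsupport _) hts,
    hts.trans (Icc_subset_Ioo hac hdb)⟩
  rw [funext fun x => (hψ.hasDerivAt_integral_Iic x).deriv]
  exact hψ.1

end IsTestFunction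

theorem exists_isTestFunction_integral_eq_one (hab : a < b) :
    ∃ ψ, IsTestFunction a b ψ ∧ ∫ x, ψ x = 1 := by
  let f : ContDiffBump ((a + b) / 2) := ⟨(b - a) / 8, (b - a) / 4, by linarith, by linarith⟩
  refine ⟨f.normed volume, ⟨f.contDiff_normed, f.hasCompactSupport_normed, ?_⟩, f.integral_normed⟩
  rw [f.tsupport_normed_eq, Real.closedBall_eq_Icc]
  exact Icc_subset_Ioo (by linarith : a < (a + b) / 2 - (b - a) / 4)
    (by linarith : (a + b) / 2 + (b - a) / 4 < b)

theorem integral_mul_eq_integral_mul_of_weak_deriv_eq_zero (hw : IntegrableOn w (Ioo a b))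
    (h : ∀ φ, IsTestFunction a b φ → ∫ x in Ioo a b, w x * deriv φ x = 0)
    (hφ : IsTestFunction a b φ) (hφ1 : ∫ x, φ x = 1) (hψ : IsTestFunction a b ψ) :
    ∫ x in Ioo a b, w x * ψ x = (∫ x, ψ x) * ∫ x in Ioo a b, w x * φ x := by
  set c := ∫ x, ψ x
  have hθ := hψ.sub_const_mul hφ c
  have hθ0 : ∫ x, (ψ x - c * φ x) = 0 := by
    rw [integral_sub hψ.integrable (hφ.integrable.const_mul c), integral_const_mul, hφ1, mul_one,
      sub_self]
  have hw0 := h _ (hθ.integral_Iic hθ0)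
  rw [funext fun x => (hθ.hasDerivAt_integral_Iic x).deriv] at hw0
  simp only [mul_sub, mul_left_comm _ c] at hw0
  rw [integral_sub (integrableOn_Ioo_mul hw hψ.continuous.continuousOn)
    ((integrableOn_Ioo_mul hw hφ.continuous.continuousOn).const_mul c), integral_const_mul] at hw0
  exact sub_eq_zero.1 hw0

theorem exists_eqOn_const_of_weak_deriv_eq_zero (hab : a < b) (hw : ContinuousOn w (Icc a b))
    (h : ∀ φ, IsTestFunction a b φ → ∫ x in Ioo a b, w x * deriv φ x = 0) :
    ∃ c, EqOn w (fun _ => c) (Icc a b) := by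
  obtain ⟨φ, hφ, hφ1⟩ := exists_isTestFunction_integral_eq_one hab
  have hwi := integrableOn_Ioo_of_continuousOn hw
  set c := ∫ x in Ioo a b, w x * φ x
  have hae : ∀ᵐ x, x ∈ Ioo a b → w x - c = 0 := by
    refine isOpen_Ioo.ae_eq_zero_of_integral_contDiff_smul_eq_zero
      (hwi.sub (by simp)).locallyIntegrableOn fun ψ hψ₁ hψ₂ hψ₃ => ?_
    have hψ : IsTestFunction a b ψ := ⟨hψ₁, hψ₂, hψ₃⟩
    have hInt : ∫ x in Ioo a b, (w x - c) * ψ x = 0 := by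
      simp only [sub_mul]
      rw [integral_sub (integrableOn_Ioo_mul hwi hψ.continuous.continuousOn)
        (hψ.integrable.const_mul c).integrableOn, integral_const_mul, hψ.setIntegral_eq_integral,
        integral_mul_eq_integral_mul_of_weak_deriv_eq_zero hwi h hφ hφ1 hψ, mul_comm, sub_self]
    rw [← hInt, setIntegral_eq_integral_of_forall_compl_eq_zero fun x hx => by
      rw [hψ.eq_zero_of_notMem hx, mul_zero]]
    exact integral_congr_ae (.of_forall fun x => mul_comm _ _)
  refine ⟨c, Measure.eqOn_Icc_of_ae_eq volume hab.ne ?_ hw continuousOn_const⟩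
  rw [← restrict_Ioo_eq_restrict_Icc]
  exact (ae_restrict_iff' measurableSet_Ioo).2 (hae.mono fun x hx hx' => sub_eq_zero.1 (hx hx'))

theorem integral_primitive_mul_deriv (hab : a ≤ b) (hg : IntegrableOn g (Ioo a b))
    (hφ : IsTestFunction a b φ) :
    ∫ x in Ioo a b, (∫ t in a..x, g t) * deriv φ x = -∫ x in Ioo a b, g x * φ x := by
  have hgi : IntervalIntegrable g volume a b := by
    rwa [intervalIntegrable_iff_integrableOn_Ioo_of_le hab]
  have hparts := (hgi.absolutelyContinuousOnInterval_intervalIntegral (c := a)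
    (by simp)).integral_mul_deriv_eq_deriv_mul
      (hφ.1.of_le (by simp)).contDiffOn.absolutelyContinuousOnInterval
  rw [← integral_Ioc_eq_integral_Ioo, ← integral_Ioc_eq_integral_Ioo,
    ← intervalIntegral.integral_of_le hab, ← intervalIntegral.integral_of_le hab, hparts,
    hφ.apply_right, hφ.apply_left]
  simp only [mul_zero, sub_zero, zero_sub, neg_inj]
  refine intervalIntegral.integral_congr_ae ?_
  filter_upwards [hgi.ae_hasDerivAt_integral] with x hx hx'
  rw [(hx (uIoc_subset_uIcc hx') a (by simp)).deriv]

theorem isSobolevPair_primitive (hab : a ≤ b) (hg : MemLp g 2 (volume.restrict (Ioo a b)))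
    (c : ℝ) : IsSobolevPair a b (fun x => c + ∫ t in a..x, g t) g := by
  have hgi : IntegrableOn g (Ioo a b) := hg.integrable one_le_two
  have hprim := continuousOn_integral_Icc hab hgi
  have hcont : ContinuousOn (fun x => c + ∫ t in a..x, g t) (Icc a b) :=
    continuousOn_const.add hprim
  refine ⟨hcont, memLp_Ioo_of_continuousOn hcont 2, hg, fun φ hφ => ?_⟩
  have hφ' := hφ.continuous_deriv.continuousOn (s := Icc a b)
  simp only [add_mul]
  rw [integral_add ((integrableOn_Ioo_of_continuousOn hφ').const_mul c)
    (integrableOn_Ioo_mul (integrableOn_Ioo_of_continuousOn hprim) hφ'), integral_const_mul,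
    hφ.setIntegral_deriv hab, mul_zero, zero_add, integral_primitive_mul_deriv hab hgi hφ]

namespace IsSobolevPair

theorem integrableOn (h : IsSobolevPair a b z z') : IntegrableOn z' (Ioo a b) :=
  h.2.2.1.integrable one_le_two

theorem exists_eqOn_primitive (hab : a < b) (h : IsSobolevPair a b z z') :
    ∃ c, EqOn z (fun x => c + ∫ t in a..x, z' t) (Icc a b) := by
  have hprim := continuousOn_integral_Icc hab.le h.integrableOn
  obtain ⟨c, hc⟩ := exists_eqOn_const_of_weak_deriv_eq_zero
    (w := fun x => z x - ∫ t in a..x, z' t) hab (h.1.sub hprim) fun φ hφ => by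
      have hφ' := hφ.continuous_deriv.continuousOn (s := Icc a b)
      simp only [sub_mul]
      rw [integral_sub (integrableOn_Ioo_mul (integrableOn_Ioo_of_continuousOn h.1) hφ')
        (integrableOn_Ioo_mul (integrableOn_Ioo_of_continuousOn hprim) hφ'), h.2.2.2 φ hφ,
        integral_primitive_mul_deriv hab.le h.integrableOn hφ, sub_self]
  exact ⟨c, fun x hx => eq_add_of_sub_eq (hc hx)⟩

theorem setIntegral_Ioc (hab : a < b) (h : IsSobolevPair a b z z') {x y : ℝ} (hx : a ≤ x)
    (hxy : x ≤ y) (hy : y ≤ b) : ∫ t in Ioc x y, z' t = z y - z x := by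
  have hInt : ∀ {s}, a ≤ s → s ≤ b → IntervalIntegrable z' volume a s := fun has hsb =>
    (intervalIntegrable_iff_integrableOn_Ioo_of_le has).2
      (h.integrableOn.mono_set (Ioo_subset_Ioo_right hsb))
  obtain ⟨c, hc⟩ := h.exists_eqOn_primitive hab
  rw [hc ⟨hx, hxy.trans hy⟩, hc ⟨hx.trans hxy, hy⟩, add_sub_add_left_eq_sub,
    intervalIntegral.integral_interval_sub_left (hInt (hx.trans hxy) hy) (hInt hx (hxy.trans hy)),
    intervalIntegral.integral_of_le hxy]

end IsSobolevPair

theorem abs_le_of_eLpNorm_top_le (hab : a ≠ b) (hz : ContinuousOn z (Icc a b)) {C : ℝ}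
    (hC : 0 ≤ C) (h : eLpNorm z ∞ (volume.restrict (Ioo a b)) ≤ ENNReal.ofReal C) {x : ℝ}
    (hx : x ∈ Icc a b) : |z x| ≤ C := by
  have hae : ∀ᵐ x ∂(volume.restrict (Icc a b)), |z x| ≤ C := by
    rw [eLpNorm_exponent_top] at h
    rw [← restrict_Ioo_eq_restrict_Icc]
    filter_upwards [ae_le_eLpNormEssSup (f := z) (μ := volume.restrict (Ioo a b))] with x hx
    have hx := hx.trans h
    rwa [Real.enorm_eq_ofReal_abs, ENNReal.ofReal_le_ofReal_iff hC] at hx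
  exact max_eq_right_iff.1 (Measure.eqOn_Icc_of_ae_eq volume hab
    (hae.mono fun x hx => max_eq_right (a := |z x|) hx) (hz.abs.sup continuousOn_const)
    continuousOn_const hx)

end Interval

theorem sum_range_sub_mul (ζ r : ℕ → ℝ) (n : ℕ) :
    ∑ k ∈ Finset.range n, (ζ (k + 1) - ζ k) * r k =
      ζ n * r n - ζ 0 * r 0 + ∑ k ∈ Finset.range n, ζ (k + 1) * (r k - r (k + 1)) := by
  induction n with
  | zero => simp
  | succ n ih => rw [Finset.sum_range_succ, ih, Finset.sum_range_succ]; ring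

theorem abs_add_sum_sub_mul_le_one {ζ r : ℕ → ℝ} (hζ : ∀ k, |ζ k| ≤ 1) (hr : Antitone r)
    (hr0 : ∀ k, 0 ≤ r k) (hr1 : r 0 ≤ 1) (n : ℕ) :
    |ζ 0 + ∑ k ∈ Finset.range n, (ζ (k + 1) - ζ k) * r k| ≤ 1 := by
  have hmul : ∀ k {c : ℝ}, 0 ≤ c → |ζ k * c| ≤ c := fun k c hc => by
    rw [abs_mul, abs_of_nonneg hc]
    exact mul_le_of_le_one_left hc (hζ k)
  calc |ζ 0 + ∑ k ∈ Finset.range n, (ζ (k + 1) - ζ k) * r k|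
      = |ζ n * r n + ζ 0 * (1 - r 0) + ∑ k ∈ Finset.range n, ζ (k + 1) * (r k - r (k + 1))| := by
        rw [sum_range_sub_mul]
        ring_nf
    _ ≤ r n + (1 - r 0) + ∑ k ∈ Finset.range n, (r k - r (k + 1)) :=
        (abs_add_three _ _ _).trans <| add_le_add_three (hmul n (hr0 n))
          (hmul 0 (sub_nonneg.2 hr1)) <| (Finset.abs_sum_le_sum_abs _ _).trans <|
            Finset.sum_le_sum fun k _ => hmul (k + 1) (sub_nonneg.2 (hr k.le_succ))
    _ = 1 := by rw [Finset.sum_range_sub']; ring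

/-- The derivative of `transitionField`. -/
noncomputable def transitionDeriv (x ζ : ℕ → ℝ) (δ : ℝ) (n : ℕ) (y : ℝ) : ℝ :=
  ∑ k ∈ Finset.range n, (ζ (k + 1) - ζ k) * (Ioc (x k) (x k + δ)).indicator (fun _ => δ⁻¹) y

/-- The piecewise linear field on an interval with left endpoint `a` that starts at the value `ζ 0`
and, for each `k < n`, adds the increment `ζ (k + 1) - ζ k` linearly over `[x k, x k + δ]`; it is
written as a primitive so that its weak derivative is immediate. -/
noncomputable def transitionField (a : ℝ) (x ζ : ℕ → ℝ) (δ : ℝ) (n : ℕ) (y : ℝ) : ℝ :=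
  ζ 0 + ∫ t in a..y, transitionDeriv x ζ δ n t

section TransitionField

variable {a b δ : ℝ} {x : ℕ → ℝ} {n : ℕ}

theorem isSobolevPair_transitionField (hab : a ≤ b) (x ζ : ℕ → ℝ) (δ : ℝ) (n : ℕ) :
    IsSobolevPair a b (transitionField a x ζ δ n) (transitionDeriv x ζ δ n) :=
  have hmem : MemLp (transitionDeriv x ζ δ n) 2 (volume.restrict (Ioo a b)) :=
    memLp_finsetSum _ fun _ _ => ((memLp_const δ⁻¹).indicator measurableSet_Ioc).const_mul _
  isSobolevPair_primitive hab hmem (ζ 0)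

theorem transitionField_left (a : ℝ) (x ζ : ℕ → ℝ) (δ : ℝ) (n : ℕ) :
    transitionField a x ζ δ n a = ζ 0 := by
  rw [transitionField, intervalIntegral.integral_same, add_zero]

theorem transitionField_apply (hx : ∀ k < n, a ≤ x k) (ζ : ℕ → ℝ) {y : ℝ} (hy : a ≤ y) :
    transitionField a x ζ δ n y =
      ζ 0 + ∑ k ∈ Finset.range n, (ζ (k + 1) - ζ k) * (max (min (y - x k) δ) 0 * δ⁻¹) := by
  simp only [transitionField, transitionDeriv, intervalIntegral.integral_of_le hy]
  rw [integral_finsetSum _ fun k _ =>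
    ((integrable_const _).indicator measurableSet_Ioc).const_mul _]
  congr 1
  refine Finset.sum_congr rfl fun k hk => ?_
  rw [integral_const_mul, setIntegral_indicator measurableSet_Ioc, Ioc_inter_Ioc,
    max_eq_right (hx k (Finset.mem_range.1 hk)), setIntegral_const, smul_eq_mul, Measure.real,
    Real.volume_Ioc, ENNReal.toReal_ofReal', ← min_sub_sub_right, add_sub_cancel_left]

theorem transitionField_right (hδ : 0 < δ) (hx : ∀ k < n, a ≤ x k) (hxb : ∀ k < n, x k + δ ≤ b)
    (hab : a ≤ b) (ζ : ℕ → ℝ) : transitionField a x ζ δ n b = ζ n := by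
  have hramp : ∀ k ∈ Finset.range n,
      (ζ (k + 1) - ζ k) * (max (min (b - x k) δ) 0 * δ⁻¹) = ζ (k + 1) - ζ k := fun k hk => by
    rw [min_eq_right (by linarith [hxb k (Finset.mem_range.1 hk)]), max_eq_left hδ.le,
      mul_inv_cancel₀ hδ.ne', mul_one]
  rw [transitionField_apply hx ζ hab, Finset.sum_congr rfl hramp, Finset.sum_range_sub,
    add_sub_cancel]

theorem abs_transitionField_le_one (hδ : 0 < δ) (hx : ∀ k < n, a ≤ x k) (hmono : Monotone x)
    {ζ : ℕ → ℝ} (hζ : ∀ k, |ζ k| ≤ 1) {y : ℝ} (hy : a ≤ y) :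
    |transitionField a x ζ δ n y| ≤ 1 := by
  rw [transitionField_apply hx ζ hy]
  refine abs_add_sum_sub_mul_le_one hζ (fun i j hij => ?_) (fun k => by positivity) ?_ n
  · have := hmono hij
    gcongr
  · rw [← div_eq_mul_inv, div_le_one hδ]
    exact max_le (min_le_right _ _) hδ.le

theorem integral_mul_transitionDeriv (hx : ∀ k < n, a ≤ x k) (hxb : ∀ k < n, x k + δ ≤ b)
    (ζ : ℕ → ℝ) {u : ℝ → ℝ} (hu : IntegrableOn u (Ioo a b)) :
    ∫ y in Ioo a b, u y * transitionDeriv x ζ δ n y =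
      ∑ k ∈ Finset.range n, (ζ (k + 1) - ζ k) * (δ⁻¹ * ∫ y in Ioc (x k) (x k + δ), u y) := by
  have hu' : IntegrableOn u (Ioc a b) := by
    rwa [integrableOn_Ioc_iff_integrableOn_Ioo]
  have hprod : ∀ y, u y * transitionDeriv x ζ δ n y = ∑ k ∈ Finset.range n,
      (ζ (k + 1) - ζ k) * (δ⁻¹ * (Ioc (x k) (x k + δ)).indicator u y) := fun y => by
    rw [transitionDeriv, Finset.mul_sum]
    refine Finset.sum_congr rfl fun k _ => ?_
    by_cases h : y ∈ Ioc (x k) (x k + δ)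
    · simp only [indicator_of_mem h]; ring
    · simp only [indicator_of_notMem h, mul_zero]
  simp only [hprod]
  rw [← integral_Ioc_eq_integral_Ioo, integral_finsetSum _ fun k _ =>
    ((hu'.indicator measurableSet_Ioc).const_mul _).const_mul _]
  refine Finset.sum_congr rfl fun k hk => ?_
  have hk := Finset.mem_range.1 hk
  rw [integral_const_mul, integral_const_mul, setIntegral_indicator measurableSet_Ioc,
    Ioc_inter_Ioc, max_eq_right (hx k hk), min_eq_right (hxb k hk)]

end TransitionField

section BoundedVariation

variable {a b C : ℝ} {u : ℝ → ℝ}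

theorem integral_setIntegral_Ici {μ ν : Measure ℝ} [IsFiniteMeasure μ] [SFinite ν] {g : ℝ → ℝ}
    (hg : Integrable g ν) :
    ∫ x, ∫ y in Ici x, g y ∂ν ∂μ = ∫ y, μ.real (Iic y) * g y ∂ν := by
  have hInt : Integrable (Function.uncurry fun x y => (Ici x).indicator g y) (μ.prod ν) :=
    (hg.comp_snd μ).indicator (measurableSet_le measurable_fst measurable_snd)
  simp only [← integral_indicator measurableSet_Ici]
  rw [integral_integral_swap hInt]
  refine integral_congr_ae (.of_forall fun y => ?_)
  have hswap : (fun x => (Ici x).indicator g y) = (Iic y).indicator fun _ => g y := rfl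
  simp only [hswap]
  rw [integral_indicator_const _ measurableSet_Iic, smul_eq_mul]

theorem integrableOn_stieltjesFunction (f : StieltjesFunction ℝ) (a b : ℝ) :
    IntegrableOn f (Icc a b) :=
  f.mono.locallyIntegrable.integrableOn_isCompact isCompact_Icc

theorem integral_stieltjesFunction_mul_deriv (hab : a ≤ b) (f : StieltjesFunction ℝ) {φ : ℝ → ℝ}
    (hφ : IsTestFunction a b φ) :
    ∫ x in Ioo a b, f x * deriv φ x = -∫ x in Ioo a b, φ x ∂f.measure := by
  have hfin : IsFiniteMeasure (f.measure.restrict (Ioc a b)) := ⟨by simp [f.measure_Ioc]⟩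
  have hφ' := hφ.continuous_deriv.continuousOn (s := Icc a b)
  have hφi : IntegrableOn (deriv φ) (Ioc a b) :=
    hφ'.integrableOn_Icc.mono_set Ioc_subset_Icc_self
  have htail : ∀ x ∈ Ioc a b, ∫ y in Ici x, deriv φ y ∂volume.restrict (Ioc a b) = -φ x := by
    intro x hx
    have hinter : Ici x ∩ Ioc a b = Icc x b := by
      ext y
      exact ⟨fun h => ⟨h.1, h.2.2⟩, fun h => ⟨h.1, hx.1.trans_le h.1, h.2⟩⟩
    rw [Measure.restrict_restrict measurableSet_Ici, hinter, integral_Icc_eq_integral_Ioc,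
      ← intervalIntegral.integral_of_le hx.2, hφ.intervalIntegral_deriv, hφ.apply_right, zero_sub]
  have hmass : ∀ y ∈ Ioc a b, (f.measure.restrict (Ioc a b)).real (Iic y) = f y - f a := by
    intro y hy
    rw [measureReal_restrict_apply measurableSet_Iic, inter_comm, Ioc_inter_Iic,
      min_eq_right hy.2, Measure.real, f.measure_Ioc,
      ENNReal.toReal_ofReal (sub_nonneg.2 (f.mono hy.1.le))]
  have hswap := integral_setIntegral_Ici (μ := f.measure.restrict (Ioc a b)) hφi
  rw [setIntegral_congr_fun measurableSet_Ioc htail, integral_neg, setIntegral_congr_fun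
    measurableSet_Ioc fun y hy => congrArg (· * deriv φ y) (hmass y hy),
    integral_Ioc_eq_integral_Ioo (μ := volume)] at hswap
  simp only [sub_mul] at hswap
  rw [integral_sub (integrableOn_Ioo_mul ((integrableOn_stieltjesFunction f a b).mono_set
    Ioo_subset_Icc_self) hφ') ((integrableOn_Ioo_of_continuousOn hφ').const_mul _),
    integral_const_mul, hφ.setIntegral_deriv hab, mul_zero, sub_zero] at hswap
  rw [← hswap, setIntegral_eq_of_subset_of_forall_sdiff_eq_zero measurableSet_Ioc
    Ioo_subset_Ioc_self fun x hx => hφ.eq_zero_of_notMem hx.2]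

theorem ae_eq_stieltjesFunction {f : ℝ → ℝ} (hf : Monotone f) :
    f =ᵐ[volume] hf.stieltjesFunction := by
  filter_upwards [compl_mem_ae_iff.2 (hf.countable_not_continuousAt.measure_zero volume)] with x hx
  rw [hf.stieltjesFunction_eq]
  exact (hf.continuousWithinAt_Ioi_iff_rightLim_eq.1
    (not_not.1 hx : ContinuousAt f x).continuousWithinAt).symm

theorem memBVInterval_of_monotone_sub (hab : a ≤ b) (hu : IntegrableOn u (Ioo a b)) {P Q : ℝ → ℝ}
    (hP : Monotone P) (hQ : Monotone Q) (h : ∀ᵐ x, x ∈ Ioo a b → u x = P x - Q x) :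
    MemBVInterval a b u := by
  refine ⟨hu, hP.stieltjesFunction.measure.restrict (Ioc a b),
    hQ.stieltjesFunction.measure.restrict (Ioc a b), ⟨by simp [StieltjesFunction.measure_Ioc]⟩,
    ⟨by simp [StieltjesFunction.measure_Ioc]⟩, fun φ hφ => ?_⟩
  have hInt : ∀ f : StieltjesFunction ℝ, IntegrableOn (fun y => f y * deriv φ y) (Ioo a b) :=
    fun f => integrableOn_Ioo_mul ((integrableOn_stieltjesFunction f a b).mono_set
      Ioo_subset_Icc_self) hφ.continuous_deriv.continuousOn
  rw [Measure.restrict_restrict measurableSet_Ioo, Measure.restrict_restrict measurableSet_Ioo,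
    inter_eq_left.2 Ioo_subset_Ioc_self, neg_sub, ← neg_sub_neg,
    ← integral_stieltjesFunction_mul_deriv hab _ hφ,
    ← integral_stieltjesFunction_mul_deriv hab _ hφ, ← integral_sub (hInt _) (hInt _)]
  refine integral_congr_ae ((ae_restrict_iff' measurableSet_Ioo).2 ?_)
  filter_upwards [h, ae_eq_stieltjesFunction hP, ae_eq_stieltjesFunction hQ] with x hx hPx hQx hx'
  rw [hx hx', hPx, hQx, sub_mul]

theorem exists_monotone_eqOn_sub_of_boundedVariationOn {S : Set ℝ} (hu : BoundedVariationOn u S) :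
    ∃ P Q : ℝ → ℝ, Monotone P ∧ Monotone Q ∧ EqOn u (P - Q) S := by
  rcases S.eq_empty_or_nonempty with rfl | ⟨x₀, hx₀⟩
  · exact ⟨0, 0, monotone_const, monotone_const, eqOn_empty _ _⟩
  set v := variationOnFromTo u S x₀
  set T := (eVariationOn u S).toReal
  have hbdd : ∀ {f : ℝ → ℝ} {M : ℝ}, (∀ x ∈ S, |f x| ≤ M) →
      BddBelow (f '' S) ∧ BddAbove (f '' S) := fun {f M} hf =>
    ⟨⟨-M, forall_mem_image.2 fun x hx => (abs_le.1 (hf x hx)).1⟩,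
      ⟨M, forall_mem_image.2 fun x hx => (abs_le.1 (hf x hx)).2⟩⟩
  have hv : ∀ x, |v x| ≤ T := fun x => variationOnFromTo.abs_le_eVariationOn hu
  have hvu : ∀ x ∈ S, |(v - u) x| ≤ T + (T + |u x₀|) := fun x hx => by
    have hdist := hu.dist_le hx hx₀
    rw [Real.dist_eq] at hdist
    calc |v x - u x| ≤ |v x| + (|u x - u x₀| + |u x₀|) :=
          (abs_sub _ _).trans (by linarith [abs_sub_abs_le_abs_sub (u x) (u x₀)])
      _ ≤ T + (T + |u x₀|) := by linarith [hv x]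
  obtain ⟨P, hP, hPv⟩ := (variationOnFromTo.monotoneOn hu.locallyBoundedVariationOn hx₀
    ).exists_monotone_extension (hbdd fun x _ => hv x).1 (hbdd fun x _ => hv x).2
  obtain ⟨Q, hQ, hQv⟩ := (variationOnFromTo.sub_self_monotoneOn hu.locallyBoundedVariationOn hx₀
    ).exists_monotone_extension (hbdd hvu).1 (hbdd hvu).2
  exact ⟨P, Q, hP, hQ, fun x hx => by simp [← hPv hx, ← hQv hx]⟩

/-- The distributional variation of `u` on `(a, b)` is at most `C`, tested against the fields of
`W^{1,2}(a, b)` that vanish at both endpoints. -/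
def WeakVariationLE (a b : ℝ) (u : ℝ → ℝ) (C : ℝ) : Prop :=
  ∀ z z', IsSobolevPair a b z z' → z a = 0 → z b = 0 → (∀ y ∈ Icc a b, |z y| ≤ 1) →
    |∫ x in Ioo a b, u x * z' x| ≤ C

/-- The points of `(a, b)` at which `u` is the derivative of its own primitive. -/
def regularPoints (a b : ℝ) (u : ℝ → ℝ) : Set ℝ :=
  {x | x ∈ Ioo a b ∧ HasDerivAt (fun y => ∫ t in a..y, u t) (u x) x}

theorem ae_mem_regularPoints (hab : a ≤ b) (hu : IntegrableOn u (Ioo a b)) :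
    ∀ᵐ x, x ∈ Ioo a b → x ∈ regularPoints a b u := by
  have hui : IntervalIntegrable u volume a b := by
    rwa [intervalIntegrable_iff_integrableOn_Ioo_of_le hab]
  filter_upwards [hui.ae_hasDerivAt_integral] with x hx hxab
  exact ⟨hxab, hx (uIcc_of_le hab ▸ Ioo_subset_Icc_self hxab) a left_mem_uIcc⟩

theorem tendsto_average_of_mem_regularPoints (hu : IntegrableOn u (Ioo a b)) {s : ℝ}
    (hs : s ∈ regularPoints a b u) :
    Filter.Tendsto (fun δ => δ⁻¹ * ∫ y in Ioc s (s + δ), u y) (nhdsWithin 0 (Ioi 0))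
      (nhds (u s)) := by
  obtain ⟨⟨has, hsb⟩, hderiv⟩ := hs
  have hInt : ∀ {y}, a ≤ y → y ≤ b → IntervalIntegrable u volume a y := fun hay hyb =>
    (intervalIntegrable_iff_integrableOn_Ioo_of_le hay).2 (hu.mono_set (Ioo_subset_Ioo_right hyb))
  refine ((hasDerivAt_iff_tendsto_slope_zero.1 hderiv).mono_left
    (nhdsWithin_mono 0 fun δ hδ => hδ.ne')).congr' ?_
  filter_upwards [Ioo_mem_nhdsGT (sub_pos.2 hsb)] with δ ⟨hδ0, hδb⟩
  rw [intervalIntegral.integral_interval_sub_left (hInt (by linarith) (by linarith))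
    (hInt has.le hsb.le), intervalIntegral.integral_of_le (by linarith), smul_eq_mul]

theorem WeakVariationLE.sum_sub_mul_le (hab : a ≤ b) (hu : IntegrableOn u (Ioo a b))
    (hC : WeakVariationLE a b u C) {s ζ : ℕ → ℝ} (hs : Monotone s)
    (hsmem : ∀ k, s k ∈ regularPoints a b u) (hζ : ∀ k, |ζ k| ≤ 1) {n : ℕ} (hζ0 : ζ 0 = 0)
    (hζn : ζ n = 0) : ∑ k ∈ Finset.range n, (ζ (k + 1) - ζ k) * u (s k) ≤ C := by
  refine le_of_tendsto (tendsto_finsetSum _ fun k _ =>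
    (tendsto_average_of_mem_regularPoints hu (hsmem k)).const_mul (ζ (k + 1) - ζ k)) ?_
  filter_upwards [Ioo_mem_nhdsGT (sub_pos.2 (hsmem n).1.2)] with δ ⟨hδ0, hδb⟩
  have hsa : ∀ k < n, a ≤ s k := fun k _ => (hsmem k).1.1.le
  have hsb : ∀ k < n, s k + δ ≤ b := fun k hk => by linarith [hs hk.le]
  rw [← integral_mul_transitionDeriv hsa hsb ζ hu]
  exact (le_abs_self _).trans <| hC _ _ (isSobolevPair_transitionField hab s ζ δ n)
    ((transitionField_left a s ζ δ n).trans hζ0)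
    ((transitionField_right hδ0 hsa hsb hab ζ).trans hζn) fun y hy =>
      abs_transitionField_le_one hδ0 hsa hs hζ hy.1

theorem WeakVariationLE.sum_abs_sub_le (hab : a ≤ b) (hu : IntegrableOn u (Ioo a b))
    (hC : WeakVariationLE a b u C) {s : ℕ → ℝ} (hs : Monotone s)
    (hsmem : ∀ k, s k ∈ regularPoints a b u) (n : ℕ) :
    ∑ k ∈ Finset.range n, |u (s (k + 1)) - u (s k)| ≤ C := by
  let ζ : ℕ → ℝ := fun k => if k = 0 ∨ k = n + 1 then 0 else
    SignType.sign (u (s (k - 1)) - u (s k))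
  have hζ : ∀ k, |ζ k| ≤ 1 := fun k => by
    simp only [ζ]
    split_ifs
    · simp
    · exact abs_coe_sign_le_one _
  have hle := hC.sum_sub_mul_le hab hu hs hsmem hζ (n := n + 1) (by simp [ζ]) (by simp [ζ])
  rw [Finset.sum_range_succ, sum_range_sub_mul] at hle
  have hvar : ∑ k ∈ Finset.range n, ζ (k + 1) * (u (s k) - u (s (k + 1))) =
      ∑ k ∈ Finset.range n, |u (s (k + 1)) - u (s k)| := by
    refine Finset.sum_congr rfl fun k hk => ?_
    have hk : ¬ (k + 1 = 0 ∨ k + 1 = n + 1) := by have := Finset.mem_range.1 hk; omega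
    simp only [ζ, if_neg hk, Nat.add_sub_cancel, sign_mul_self, abs_sub_comm]
  have hζn : ζ (n + 1) = 0 := by simp [ζ]
  have hζ0 : ζ 0 = 0 := by simp [ζ]
  rw [hvar, hζn, hζ0] at hle
  linarith

theorem memBVInterval_of_weakVariationLE (hab : a ≤ b) (hu : IntegrableOn u (Ioo a b))
    (hC : WeakVariationLE a b u C) : MemBVInterval a b u := by
  have hvar : eVariationOn u (regularPoints a b u) ≤ ENNReal.ofReal C := by
    refine iSup_le fun ⟨n, s, hs, hsmem⟩ => ?_
    simp only [edist_dist, Real.dist_eq]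
    rw [← ENNReal.ofReal_sum_of_nonneg fun _ _ => abs_nonneg _]
    exact ENNReal.ofReal_le_ofReal (hC.sum_abs_sub_le hab hu hs hsmem n)
  obtain ⟨P, Q, hP, hQ, hPQ⟩ := exists_monotone_eqOn_sub_of_boundedVariationOn
    (ne_top_of_le_ne_top ENNReal.ofReal_ne_top hvar)
  refine memBVInterval_of_monotone_sub hab hu hP hQ ?_
  filter_upwards [ae_mem_regularPoints hab hu] with x hx hxab
  exact hPQ (hx hxab)

end BoundedVariation

variable {V E : Type*} (G : MetricGraph V E)

section CoordSet

variable {G} {A : Set G.Point} {e : E} {x : ℝ}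

theorem point_of_mem_Ioo (h : x ∈ Ioo 0 (G.len e)) : G.point e x = Sum.inr ⟨e, ⟨x, h⟩⟩ :=
  dif_pos h

theorem exists_point_eq_inl (h : x ∉ Ioo 0 (G.len e)) : ∃ v, G.point e x = Sum.inl v := by
  by_cases h0 : x ≤ 0
  · exact ⟨G.init e, (dif_neg h).trans (if_pos h0)⟩
  · exact ⟨G.term e, (dif_neg h).trans (if_neg h0)⟩

theorem exists_point_eq_iff {q : E → ℝ → Prop} :
    (∃ e', ∃ y ∈ Ioo 0 (G.len e'), G.point e x = G.point e' y ∧ q e' y) ↔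
      x ∈ Ioo 0 (G.len e) ∧ q e x := by
  refine ⟨fun ⟨e', y, hy, hp, hq⟩ => ?_, fun ⟨hx, hq⟩ => ⟨e, x, hx, rfl, hq⟩⟩
  rw [point_of_mem_Ioo hy] at hp
  by_cases hx : x ∈ Ioo 0 (G.len e)
  · rw [point_of_mem_Ioo hx] at hp
    obtain ⟨rfl, hxy⟩ := Sigma.mk.inj_iff.1 (Sum.inr_injective hp)
    obtain rfl : x = y := congrArg Subtype.val (eq_of_heq hxy)
    exact ⟨hx, hq⟩
  · obtain ⟨v, hv⟩ := exists_point_eq_inl hx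
    exact (Sum.inl_ne_inr (hv.symm.trans hp)).elim

theorem coordSet_superlevel (u : G.Fun) (t : ℝ) (e : E) :
    G.coordSet (G.superlevel u t) e = {x | x ∈ Ioo 0 (G.len e) ∧ t < u e x} := by
  ext x
  refine (and_congr_right fun _ => exists_point_eq_iff (q := fun e x => t < u e x)).trans ?_
  exact and_iff_right_of_imp fun h => Ioo_subset_Icc_self h.1

theorem coordSet_sublevel (u : G.Fun) (t : ℝ) (e : E) :
    G.coordSet (G.sublevel u t) e = {x | x ∈ Ioo 0 (G.len e) ∧ u e x < t} := by
  ext x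
  refine (and_congr_right fun _ => exists_point_eq_iff (q := fun e x => u e x < t)).trans ?_
  exact and_iff_right_of_imp fun h => Ioo_subset_Icc_self h.1

theorem coordSet_subset (A : Set G.Point) (e : E) : G.coordSet A e ⊆ Icc 0 (G.len e) :=
  fun _ h => h.1

theorem coordSet_compl (A : Set G.Point) (e : E) :
    G.coordSet Aᶜ e = Icc 0 (G.len e) \ G.coordSet A e := by
  ext x
  exact and_congr_right fun hx => (not_congr (and_iff_right hx)).symm

theorem IsMeasurable.compl (hA : G.IsMeasurable A) : G.IsMeasurable Aᶜ := fun e => by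
  rw [coordSet_compl]
  exact measurableSet_Icc.nullMeasurableSet.diff (hA e)

theorem char_of_mem (hx : x ∈ G.coordSet A e) : G.char A e x = 1 := indicator_of_mem hx _

theorem char_of_notMem (hx : x ∉ G.coordSet A e) : G.char A e x = 0 := indicator_of_notMem hx _

theorem char_nonneg (A : Set G.Point) (e : E) (x : ℝ) : 0 ≤ G.char A e x :=
  indicator_nonneg (fun _ _ => zero_le_one) x

theorem char_compl (A : Set G.Point) (hx : x ∈ Icc 0 (G.len e)) :
    G.char Aᶜ e x = 1 - G.char A e x := by
  unfold char
  rw [coordSet_compl]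
  by_cases h : x ∈ G.coordSet A e <;> simp [indicator, h, hx]

theorem char_superlevel (u : G.Fun) (t : ℝ) (hx : x ∈ Ioo 0 (G.len e)) :
    G.char (G.superlevel u t) e x = if t < u e x then 1 else 0 := by
  unfold char
  simp [coordSet_superlevel, indicator, hx.1, hx.2]

theorem integrableOn_char (hA : G.IsMeasurable A) (e : E) :
    IntegrableOn (G.char A e) (Ioo 0 (G.len e)) :=
  (integrable_const 1).indicator₀
    ((hA e).mono_ac Measure.restrict_le_self.absolutelyContinuous)

variable [Fintype E]

theorem length_eq_ofReal_sum_integral_char (hA : G.IsMeasurable A) :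
    G.length A = ENNReal.ofReal (∑ e, ∫ x in Ioo 0 (G.len e), G.char A e x) := by
  rw [ENNReal.ofReal_sum_of_nonneg fun e _ => integral_nonneg (char_nonneg A e)]
  refine Finset.sum_congr rfl fun e _ => ?_
  have hchar : ∫ x in Ioo 0 (G.len e), G.char A e x = volume.real (G.coordSet A e) := by
    have hA' := (hA e).mono_ac
      (Measure.restrict_le_self (s := Icc 0 (G.len e))).absolutelyContinuous
    rw [← integral_Icc_eq_integral_Ioo, char, integral_indicator₀ hA', setIntegral_const,
      measureReal_restrict_apply₀ hA', inter_eq_left.2 (coordSet_subset A e), smul_eq_mul, mul_one]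
  rw [hchar, ofReal_measureReal (measure_ne_top_of_subset (coordSet_subset A e) (by simp))]

theorem length_add_length_compl (hA : G.IsMeasurable A) :
    G.length A + G.length Aᶜ = ENNReal.ofReal G.totalLength := by
  rw [← length_univ]
  simp only [length, ← Finset.sum_add_distrib]
  refine Finset.sum_congr rfl fun e _ => ?_
  have huniv : G.coordSet univ e = Icc 0 (G.len e) := by
    ext x
    simp [coordSet]
  rw [huniv, coordSet_compl, ← measure_inter_add_sdiff₀ (Icc 0 (G.len e)) (hA e),
    inter_eq_right.2 (coordSet_subset A e)]

end CoordSet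

/-- The vertex at an end of an edge; the end is encoded by `true` if it is the terminal one and by
`false` if it is the initial one. -/
def endVertex (h : E × Bool) : V := cond h.2 (G.term h.1) (G.init h.1)

/-- The outward values at the ends of the edges of a field which takes the value `p e` at the
initial end and the value `q e` at the terminal end of `e`. -/
def outwardValue (p q : E → ℝ) (h : E × Bool) : ℝ := cond h.2 (q h.1) (-p h.1)

section Kirchhoff

variable [Fintype E]

open Classical in
/-- The Kirchhoff condition for the values `p e` at the initial ends and `q e` at the terminal ends
of the edges. -/
def IsKirchhoff (p q : E → ℝ) : Prop :=
  ∀ v, ∑ h with G.endVertex h = v, outwardValue p q h = 0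

variable {G} {p q : E → ℝ}

theorem sum_outwardValue (p q : E → ℝ) : ∑ h, outwardValue p q h = ∑ e, (q e - p e) := by
  rw [Fintype.sum_prod_type]
  exact Finset.sum_congr rfl fun e _ => by simp [outwardValue, sub_eq_add_neg]

theorem IsKirchhoff.sum_sub_eq_zero (h : G.IsKirchhoff p q) : ∑ e, (q e - p e) = 0 := by
  classical
  rw [← sum_outwardValue, ← Finset.sum_fiberwise_of_maps_to (g := G.endVertex)
    (t := Finset.univ.image G.endVertex) fun h _ => Finset.mem_image_of_mem _ (Finset.mem_univ h)]
  exact Finset.sum_eq_zero fun v _ => by convert h v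

open Classical in
theorem sum_outward_eq_sum_outwardValue (z : G.Fun) (v : V) :
    ∑ e ∈ G.incidentEdges v, G.outward z e v =
      ∑ h with G.endVertex h = v, outwardValue (fun e => z e 0) (fun e => z e (G.len e)) h := by
  rw [incidentEdges, Finset.sum_filter, Finset.sum_filter, Fintype.sum_prod_type]
  refine Finset.sum_congr rfl fun e _ => ?_
  have hloop := G.no_loops e
  rw [Fintype.sum_bool]
  by_cases hi : G.init e = v
  · have ht : G.term e ≠ v := fun ht => hloop (hi.trans ht.symm)
    simp [outward, endVertex, outwardValue, hi, ht, ht.symm]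
  · by_cases ht : G.term e = v <;> simp [outward, endVertex, outwardValue, hi, ht]

theorem memXK_iff {z z' : G.Fun} : G.MemXK z z' ↔
    (∀ e, IsSobolevPair 0 (G.len e) (z e) (z' e)) ∧
      G.IsKirchhoff (fun e => z e 0) fun e => z e (G.len e) :=
  and_congr_right fun _ => forall_congr' fun v => by rw [sum_outward_eq_sum_outwardValue]

theorem MemXK.integrableOn {z z' : G.Fun} (hz : G.MemXK z z') (e : E) :
    IntegrableOn (z' e) (Ioo 0 (G.len e)) :=
  (hz.1 e).integrableOn

theorem MemXK.sum_integral_eq_zero {z z' : G.Fun} (hz : G.MemXK z z') :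
    ∑ e, ∫ x in Ioo 0 (G.len e), z' e x = 0 := by
  refine Eq.trans (Finset.sum_congr rfl fun e _ => ?_) (memXK_iff.1 hz).2.sum_sub_eq_zero
  rw [← integral_Ioc_eq_integral_Ioo,
    (hz.1 e).setIntegral_Ioc (G.len_pos e) le_rfl (G.len_pos e).le le_rfl]

end Kirchhoff

section TotalVariation

variable {G} [Fintype E] {u : G.Fun}

theorem ofReal_abs_sum_le_TV (u : G.Fun) {z z' : G.Fun} (hz : G.MemXK z z')
    (hle : ∀ e, ∀ y ∈ Icc 0 (G.len e), |z e y| ≤ 1) :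
    ENNReal.ofReal |∑ e, ∫ x in Ioo 0 (G.len e), u e x * z' e x| ≤ G.TV u := by
  refine le_iSup_of_le z <| le_iSup_of_le z' <| le_iSup_of_le hz <|
    le_iSup_of_le (fun e => ?_) le_rfl
  rw [eLpNorm_exponent_top]
  refine eLpNormEssSup_le_of_ae_enorm_bound
    ((ae_restrict_mem measurableSet_Ioo).mono fun x hx => ?_)
  rw [Real.enorm_eq_ofReal_abs, ENNReal.ofReal_le_one]
  exact hle e x (Ioo_subset_Icc_self hx)

theorem TV_le_of_forall {C : ℝ≥0∞}
    (h : ∀ z z', G.MemXK z z' → (∀ e, ∀ y ∈ Icc 0 (G.len e), |z e y| ≤ 1) →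
      ENNReal.ofReal |∑ e, ∫ x in Ioo 0 (G.len e), u e x * z' e x| ≤ C) : G.TV u ≤ C :=
  iSup₂_le fun z z' => iSup₂_le fun hz hle => h z z' hz fun e _ hy =>
    abs_le_of_eLpNorm_top_le (G.len_pos e).ne (hz.1 e).1 zero_le_one (by simpa using hle e) hy

theorem TV_eq_ofReal_abs_mul_TV {v : G.Fun} {c : ℝ}
    (h : ∀ z z', G.MemXK z z' → ∑ e, ∫ x in Ioo 0 (G.len e), u e x * z' e x =
      c * ∑ e, ∫ x in Ioo 0 (G.len e), v e x * z' e x) :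
    G.TV u = ENNReal.ofReal |c| * G.TV v := by
  simp only [TV, ENNReal.mul_iSup]
  refine iSup_congr fun z => iSup_congr fun z' => iSup_congr fun hz => iSup_congr fun _ => ?_
  rw [h z z' hz, abs_mul, ENNReal.ofReal_mul (abs_nonneg c)]

theorem TV_congr {v : G.Fun} (h : ∀ e, EqOn (u e) (v e) (Ioo 0 (G.len e))) : G.TV u = G.TV v := by
  have hone := TV_eq_ofReal_abs_mul_TV (u := u) (v := v) (c := 1) fun z z' _ => by
    rw [one_mul]
    exact Finset.sum_congr rfl fun e _ => setIntegral_congr_fun measurableSet_Ioo fun x hx =>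
      congrArg (· * z' e x) (h e hx)
  rwa [abs_one, ENNReal.ofReal_one, one_mul] at hone

open Classical in
/-- The function on the graph that is equal to `f` on the edge `e` and vanishes on all other
edges. -/
noncomputable def extendEdge (G : MetricGraph V E) (e : E) (f : ℝ → ℝ) : G.Fun := Pi.single e f

theorem memXK_extendEdge {e : E} {z z' : ℝ → ℝ} (hz : IsSobolevPair 0 (G.len e) z z')
    (h0 : z 0 = 0) (hlen : z (G.len e) = 0) : G.MemXK (G.extendEdge e z) (G.extendEdge e z') := by
  refine ⟨fun e' => ?_, fun v => Finset.sum_eq_zero fun e' _ => ?_⟩ <;>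
    obtain rfl | he := eq_or_ne e' e
  · simpa [extendEdge] using hz
  · simpa [extendEdge, he] using ⟨continuousOn_const, MemLp.zero, MemLp.zero, by simp⟩
  · simp [outward, extendEdge, h0, hlen]
  · simp [outward, extendEdge, he]

theorem weakVariationLE_of_TV_ne_top (h : G.TV u ≠ ⊤) (e : E) :
    WeakVariationLE 0 (G.len e) (u e) (G.TV u).toReal := by
  intro z z' hz h0 hlen hle
  have hTV := ofReal_abs_sum_le_TV u (memXK_extendEdge hz h0 hlen) fun e' y hy => by
    obtain rfl | he := eq_or_ne e' e
    · simpa [extendEdge] using hle y hy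
    · simp [extendEdge, he]
  rw [Finset.sum_eq_single e (fun e' _ he => by simp [extendEdge, he]) (by simp)] at hTV
  simpa [extendEdge] using (ENNReal.ofReal_le_iff_le_toReal h).1 hTV

theorem memBV_of_TV_ne_top (hu : ∀ e, IntegrableOn (u e) (Ioo 0 (G.len e))) (h : G.TV u ≠ ⊤) :
    G.MemBV u := fun e =>
  memBVInterval_of_weakVariationLE (G.len_pos e).le (hu e) (weakVariationLE_of_TV_ne_top h e)

end TotalVariation

/-- The length of a cell when the edge `e` is divided into `n + 1` cells of equal length. -/
noncomputable def mesh (n : ℕ) (e : E) : ℝ := G.len e / (n + 1)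

/-- The cell with index `p.2` on the edge `p.1` when every edge is divided into `n + 1` cells of
equal length. -/
def cell (n : ℕ) (p : E × ℕ) : Set ℝ :=
  Ioc (p.2 * G.mesh n p.1) (p.2 * G.mesh n p.1 + G.mesh n p.1)

/-- The mean of a function over a cell. -/
noncomputable def cellMean (n : ℕ) (u : G.Fun) (p : E × ℕ) : ℝ :=
  ⨍ x in G.cell n p, u p.1 x

/-- The step function with the value `a p` on the cell `p`. -/
noncomputable def stepFun (n : ℕ) (a : E × ℕ → ℝ) : G.Fun :=
  fun e x => a (e, ⌈x / G.mesh n e⌉₊ - 1)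

section Cells

variable {G} {n : ℕ} {e : E}

theorem mesh_pos : 0 < G.mesh n e := div_pos (G.len_pos e) n.cast_add_one_pos

theorem add_one_mul_mesh : (n + 1) * G.mesh n e = G.len e :=
  mul_div_cancel₀ _ n.cast_add_one_pos.ne'

theorem natCast_mul_mesh_add (k : ℕ) :
    k * G.mesh n e + G.mesh n e = (k + 1 : ℕ) * G.mesh n e := by
  push_cast
  ring

theorem mul_mesh_le_len {k : ℕ} (hk : k ≤ n + 1) : k * G.mesh n e ≤ G.len e := by
  rw [← add_one_mul_mesh (n := n)]
  gcongr
  · exact mesh_pos.le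
  · exact_mod_cast hk

theorem cell_subset {k : ℕ} (hk : k < n + 1) : G.cell n (e, k) ⊆ Ioc 0 (G.len e) := by
  refine Ioc_subset_Ioc (mul_nonneg k.cast_nonneg mesh_pos.le) ?_
  rw [natCast_mul_mesh_add]
  exact mul_mesh_le_len hk

theorem volume_real_cell (p : E × ℕ) : volume.real (G.cell n p) = G.mesh n p.1 := by
  simp [cell, mesh_pos.le]

theorem cellMean_eq (u : G.Fun) (p : E × ℕ) :
    G.cellMean n u p = (G.mesh n p.1)⁻¹ * ∫ x in G.cell n p, u p.1 x := by
  rw [cellMean, setAverage_eq, volume_real_cell, smul_eq_mul]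

theorem ceil_div_mesh_eq_iff {k : ℕ} {x : ℝ} :
    ⌈x / G.mesh n e⌉₊ = k + 1 ↔ x ∈ G.cell n (e, k) := by
  rw [Nat.ceil_eq_iff k.succ_ne_zero, lt_div_iff₀ mesh_pos, div_le_iff₀ mesh_pos,
    ← natCast_mul_mesh_add]
  rfl

theorem stepFun_of_mem_cell (a : E × ℕ → ℝ) {k : ℕ} {x : ℝ} (hx : x ∈ G.cell n (e, k)) :
    G.stepFun n a e x = a (e, k) := by
  rw [stepFun, ceil_div_mesh_eq_iff.2 hx, Nat.add_sub_cancel]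

theorem exists_mem_cell (n : ℕ) {x : ℝ} (hx : x ∈ Ioo 0 (G.len e)) :
    ∃ k < n + 1, x ∈ G.cell n (e, k) := by
  have hpos : 0 < ⌈x / G.mesh n e⌉₊ := Nat.ceil_pos.2 (div_pos hx.1 mesh_pos)
  have hle : ⌈x / G.mesh n e⌉₊ ≤ n + 1 := by
    rw [Nat.ceil_le, div_le_iff₀ mesh_pos]
    exact_mod_cast hx.2.le.trans_eq add_one_mul_mesh.symm
  exact ⟨⌈x / G.mesh n e⌉₊ - 1, by omega, ceil_div_mesh_eq_iff.1 (by omega)⟩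

theorem integral_eq_sum_cell {f : ℝ → ℝ} (hf : IntegrableOn f (Ioo 0 (G.len e))) :
    ∫ x in Ioo 0 (G.len e), f x = ∑ k ∈ Finset.range (n + 1), ∫ x in G.cell n (e, k), f x := by
  have hle : ∀ k : ℕ, k * G.mesh n e ≤ (k + 1 : ℕ) * G.mesh n e := fun k => by
    rw [← natCast_mul_mesh_add]
    exact le_add_of_nonneg_right mesh_pos.le
  have hsum := intervalIntegral.sum_integral_adjacent_intervals (f := f) (μ := volume)
    (a := fun k : ℕ => k * G.mesh n e) (n := n + 1) fun k hk => by
      rw [intervalIntegrable_iff_integrableOn_Ioc_of_le (hle k), ← natCast_mul_mesh_add]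
      rw [← integrableOn_Ioc_iff_integrableOn_Ioo] at hf
      exact hf.mono_set (cell_subset hk)
  rw [Nat.cast_zero, zero_mul, Nat.cast_succ, add_one_mul_mesh,
    intervalIntegral.integral_of_le (G.len_pos e).le, integral_Ioc_eq_integral_Ioo] at hsum
  rw [← hsum]
  refine Finset.sum_congr rfl fun k _ => ?_
  rw [intervalIntegral.integral_of_le (hle k), ← natCast_mul_mesh_add, cell]

theorem measurable_stepFun (n : ℕ) (a : E × ℕ → ℝ) (e : E) : Measurable (G.stepFun n a e) :=
  (measurable_from_nat (f := fun k => a (e, k - 1))).comp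
    (Nat.measurable_ceil.comp (measurable_id.div_const _))

theorem exists_abs_stepFun_le (n : ℕ) (a : E × ℕ → ℝ) (e : E) :
    ∃ C, ∀ x ∈ Ioo 0 (G.len e), |G.stepFun n a e x| ≤ C := by
  refine ⟨∑ k ∈ Finset.range (n + 1), |a (e, k)|, fun x hx => ?_⟩
  obtain ⟨k, hk, hxk⟩ := exists_mem_cell n hx
  rw [stepFun_of_mem_cell a hxk]
  exact Finset.single_le_sum (f := fun k => |a (e, k)|) (fun k _ => abs_nonneg _)
    (Finset.mem_range.2 hk)

theorem integrableOn_stepFun_mul (n : ℕ) (a : E × ℕ → ℝ) {f : ℝ → ℝ}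
    (hf : IntegrableOn f (Ioo 0 (G.len e))) :
    IntegrableOn (fun x => G.stepFun n a e x * f x) (Ioo 0 (G.len e)) := by
  obtain ⟨C, hC⟩ := exists_abs_stepFun_le (G := G) n a e
  exact hf.bdd_mul (measurable_stepFun n a e).aestronglyMeasurable
    ((ae_restrict_mem measurableSet_Ioo).mono hC)

theorem integrableOn_stepFun (n : ℕ) (a : E × ℕ → ℝ) (e : E) :
    IntegrableOn (G.stepFun n a e) (Ioo 0 (G.len e)) := by
  simpa using integrableOn_stepFun_mul (G := G) n a (f := fun _ => 1) (integrableOn_const (by simp))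

theorem integral_stepFun_mul (n : ℕ) (a : E × ℕ → ℝ) {f : ℝ → ℝ}
    (hf : IntegrableOn f (Ioo 0 (G.len e))) :
    ∫ x in Ioo 0 (G.len e), G.stepFun n a e x * f x =
      ∑ k ∈ Finset.range (n + 1), a (e, k) * ∫ x in G.cell n (e, k), f x := by
  rw [integral_eq_sum_cell (integrableOn_stepFun_mul n a hf)]
  refine Finset.sum_congr rfl fun k _ => ?_
  rw [← integral_const_mul]
  exact setIntegral_congr_fun measurableSet_Ioc fun x hx => by
    rw [stepFun_of_mem_cell a hx]

theorem integral_stepFun (n : ℕ) (a : E × ℕ → ℝ) (e : E) :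
    ∫ x in Ioo 0 (G.len e), G.stepFun n a e x =
      ∑ k ∈ Finset.range (n + 1), a (e, k) * G.mesh n e := by
  have hone := integral_stepFun_mul (G := G) (e := e) n a (f := fun _ => 1)
    (integrableOn_const (by simp))
  simpa [volume_real_cell] using hone

theorem isMeasurable_superlevel_stepFun (n : ℕ) (a : E × ℕ → ℝ) (t : ℝ) :
    G.IsMeasurable (G.superlevel (G.stepFun n a) t) := fun e => by
  rw [coordSet_superlevel]
  exact (measurableSet_Ioo.inter
    (measurableSet_lt measurable_const (measurable_stepFun n a e))).nullMeasurableSet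

end Cells

/-- The indices of the cells when every edge is divided into `n + 1` cells. -/
def cells (E : Type*) [Fintype E] (n : ℕ) : Finset (E × ℕ) := Finset.univ ×ˢ Finset.range (n + 1)

/-- The increment over the cell `p` of a field with the value `ζ e k` at the `k`-th division point
of the edge `e`. -/
def increment (ζ : E → ℕ → ℝ) (p : E × ℕ) : ℝ := ζ p.1 (p.2 + 1) - ζ p.1 p.2

section DiscreteField

variable [Fintype E]

theorem sum_cells (n : ℕ) (f : E × ℕ → ℝ) :
    ∑ p ∈ cells E n, f p = ∑ e, ∑ k ∈ Finset.range (n + 1), f (e, k) :=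
  Finset.sum_product _ _ _

/-- The discrete counterpart of the fields in `X_K(Γ)` with norm at most one: `ζ e k` is the value
at the `k`-th point of the division of the edge `e` into `n + 1` cells. -/
def IsDiscreteField (n : ℕ) (ζ : E → ℕ → ℝ) : Prop :=
  (∀ e k, |ζ e k| ≤ 1) ∧ G.IsKirchhoff (fun e => ζ e 0) fun e => ζ e (n + 1)

variable {G} {n : ℕ}

theorem IsDiscreteField.neg {ζ : E → ℕ → ℝ} (h : G.IsDiscreteField n ζ) :
    G.IsDiscreteField n fun e k => -ζ e k := by
  refine ⟨fun e k => (abs_neg _).trans_le (h.1 e k), fun v => ?_⟩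
  rw [← neg_eq_zero.2 (h.2 v), ← Finset.sum_neg_distrib]
  refine Finset.sum_congr rfl ?_
  rintro ⟨e, _ | _⟩ _ <;> rfl

theorem IsDiscreteField.sum_increment {ζ : E → ℕ → ℝ} (h : G.IsDiscreteField n ζ) :
    ∑ p ∈ cells E n, increment ζ p = 0 := by
  rw [sum_cells, ← h.2.sum_sub_eq_zero]
  exact Finset.sum_congr rfl fun e _ => Finset.sum_range_sub (ζ e) (n + 1)

theorem exists_isDiscreteField_sum_increment_mul_eq {z z' : G.Fun} (hz : G.MemXK z z')
    (hle : ∀ e, ∀ y ∈ Icc 0 (G.len e), |z e y| ≤ 1) (n : ℕ) :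
    ∃ ζ, G.IsDiscreteField n ζ ∧ ∀ a : E × ℕ → ℝ,
      ∑ e, ∫ x in Ioo 0 (G.len e), G.stepFun n a e x * z' e x =
        ∑ p ∈ cells E n, increment ζ p * a p := by
  have hnonneg : ∀ e (k : ℕ), 0 ≤ k * G.mesh n e := fun e k =>
    mul_nonneg k.cast_nonneg mesh_pos.le
  have hmin : ∀ e (k : ℕ), k ≤ n + 1 → min (k * G.mesh n e) (G.len e) = k * G.mesh n e :=
    fun e k hk => min_eq_left (mul_mesh_le_len hk)
  refine ⟨fun e k => z e (min (k * G.mesh n e) (G.len e)), ⟨fun e k => hle e _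
    ⟨le_min (hnonneg e k) (G.len_pos e).le, min_le_right _ _⟩, ?_⟩, fun a => ?_⟩
  · convert (memXK_iff.1 hz).2 using 3 with e e
    · simp [(G.len_pos e).le]
    · rw [hmin e _ le_rfl, Nat.cast_succ, add_one_mul_mesh]
  · rw [sum_cells]
    refine Finset.sum_congr rfl fun e _ => ?_
    rw [integral_stepFun_mul n a (hz.integrableOn e)]
    refine Finset.sum_congr rfl fun k hk => ?_
    have hk := Finset.mem_range.1 hk
    rw [mul_comm, increment, cell, natCast_mul_mesh_add, hmin e k hk.le, hmin e (k + 1) hk,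
      (hz.1 e).setIntegral_Ioc (G.len_pos e) (hnonneg e k) ?_ (mul_mesh_le_len hk)]
    gcongr
    · exact mesh_pos.le
    · exact k.le_succ

theorem TV_stepFun_le {a : E × ℕ → ℝ} {M : ℝ}
    (hM : ∀ ζ, G.IsDiscreteField n ζ → ∑ p ∈ cells E n, increment ζ p * a p ≤ M) :
    G.TV (G.stepFun n a) ≤ ENNReal.ofReal M := by
  refine TV_le_of_forall fun z z' hz hle => ENNReal.ofReal_le_ofReal ?_
  obtain ⟨ζ, hζ, hsum⟩ := exists_isDiscreteField_sum_increment_mul_eq hz hle n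
  rw [hsum, abs_le']
  refine ⟨hM ζ hζ, (hM _ hζ.neg).trans_eq' ?_⟩
  rw [← Finset.sum_neg_distrib]
  exact Finset.sum_congr rfl fun p _ => by simp only [increment]; ring

theorem ofReal_sum_increment_mul_cellMean_le_TV {u : G.Fun}
    (hu : ∀ e, IntegrableOn (u e) (Ioo 0 (G.len e))) {ζ : E → ℕ → ℝ}
    (hζ : G.IsDiscreteField n ζ) :
    ENNReal.ofReal (∑ p ∈ cells E n, increment ζ p * G.cellMean n u p) ≤ G.TV u := by
  have hx : ∀ e, ∀ k < n + 1, 0 ≤ k * G.mesh n e := fun e k _ =>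
    mul_nonneg k.cast_nonneg mesh_pos.le
  have hxb : ∀ e, ∀ k < n + 1, k * G.mesh n e + G.mesh n e ≤ G.len e := fun e k hk => by
    rw [natCast_mul_mesh_add]
    exact mul_mesh_le_len hk
  have hmono : ∀ e, Monotone fun k : ℕ => k * G.mesh n e := fun e =>
    Nat.mono_cast.mul_const mesh_pos.le
  let z : G.Fun := fun e => transitionField 0 (fun k => k * G.mesh n e) (ζ e) (G.mesh n e) (n + 1)
  let z' : G.Fun := fun e => transitionDeriv (fun k => k * G.mesh n e) (ζ e) (G.mesh n e) (n + 1)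
  have hz : G.MemXK z z' := by
    refine memXK_iff.2 ⟨fun e => isSobolevPair_transitionField (G.len_pos e).le _ _ _ _, ?_⟩
    simp only [z, transitionField_left,
      transitionField_right mesh_pos (hx _) (hxb _) (G.len_pos _).le]
    exact hζ.2
  have hle : ∀ e, ∀ y ∈ Icc 0 (G.len e), |z e y| ≤ 1 := fun e y hy =>
    abs_transitionField_le_one mesh_pos (hx e) (hmono e) (hζ.1 e) hy.1
  refine (ENNReal.ofReal_le_ofReal ?_).trans (ofReal_abs_sum_le_TV u hz hle)
  refine (le_abs_self _).trans_eq' ?_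
  rw [sum_cells]
  simp only [cellMean_eq]
  exact Finset.sum_congr rfl fun e _ => (integral_mul_transitionDeriv (hx e) (hxb e) _ (hu e))

theorem sum_filter_lt_increment (n : ℕ) (ζ : E → ℕ → ℝ) (a : E × ℕ → ℝ) (t : ℝ) :
    ∑ p ∈ cells E n with t < a p, increment ζ p =
      ∑ h : E × Bool with t < a (h.1, cond h.2 n 0),
          outwardValue (fun e => ζ e 0) (fun e => ζ e (n + 1)) h +
        ∑ e, ∑ k ∈ Finset.range n, ζ e (k + 1) *
          ((if t < a (e, k) then 1 else 0) - if t < a (e, k + 1) then 1 else 0) := by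
  rw [Finset.sum_filter, sum_cells, Finset.sum_filter, Fintype.sum_prod_type,
    ← Finset.sum_add_distrib]
  refine Finset.sum_congr rfl fun e _ => ?_
  have hparts := sum_range_sub_mul (ζ e) (fun k => if t < a (e, k) then 1 else 0) n
  simp only [mul_ite, mul_one, mul_zero] at hparts
  rw [Finset.sum_range_succ]
  simp only [increment, hparts, outwardValue, Fintype.sum_bool, cond_true, cond_false]
  split_ifs <;> ring

theorem exists_isDiscreteField_maximal (G : MetricGraph V E) (n : ℕ) (a : E × ℕ → ℝ) :
    ∃ ζ, G.IsDiscreteField n ζ ∧ ∀ ζ', G.IsDiscreteField n ζ' → ∀ t,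
      ∑ p ∈ cells E n with t < a p, increment ζ' p ≤
        ∑ p ∈ cells E n with t < a p, increment ζ p := by
  classical
  obtain ⟨o, hle, hbal, hmax⟩ := exists_balanced_maximal G.endVertex
    fun h : E × Bool => a (h.1, cond h.2 n 0)
  let ζ : E → ℕ → ℝ := fun e k => if k = 0 then -o (e, false) else
    if k = n + 1 then o (e, true) else SignType.sign (a (e, k - 1) - a (e, k))
  have hout : outwardValue (fun e => ζ e 0) (fun e => ζ e (n + 1)) = o := by
    ext ⟨e, _ | _⟩ <;> simp [outwardValue, ζ]
  have hInt : ∀ e, ∀ k ∈ Finset.range n,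
      ζ e (k + 1) = SignType.sign (a (e, k) - a (e, k + 1)) := fun e k hk => by
    simp [ζ, (Finset.mem_range.1 hk).ne]
  have hζ : ∀ e k, |ζ e k| ≤ 1 := fun e k => by
    unfold ζ
    split_ifs
    · exact (abs_neg _).trans_le (hle _)
    · exact hle _
    · exact abs_coe_sign_le_one _
  refine ⟨ζ, ⟨hζ, fun v => by rw [hout]; convert hbal v⟩, fun ζ' hζ' t => ?_⟩
  rw [sum_filter_lt_increment, sum_filter_lt_increment, hout]
  refine add_le_add (hmax _ ?_ (fun v => by convert hζ'.2 v) t)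
    (Finset.sum_le_sum fun e _ => Finset.sum_le_sum fun k hk => ?_)
  · rintro ⟨e, _ | _⟩
    · exact (abs_neg _).trans_le (hζ'.1 e 0)
    · exact hζ'.1 e (n + 1)
  · rw [hInt e k hk]
    exact mul_ite_sub_ite_le_sign_mul (hζ'.1 e (k + 1)) t _ _

theorem sum_integral_char_superlevel_stepFun (n : ℕ) (a : E × ℕ → ℝ) (t : ℝ) :
    ∑ e, ∫ x in Ioo 0 (G.len e), G.char (G.superlevel (G.stepFun n a) t) e x =
      ∑ p ∈ cells E n with t < a p, G.mesh n p.1 := by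
  rw [Finset.sum_filter, sum_cells]
  refine Finset.sum_congr rfl fun e _ => ?_
  refine (setIntegral_congr_fun measurableSet_Ioo fun x hx => char_superlevel _ _ hx).trans
    ((integral_stepFun n (fun p => if t < a p then 1 else 0) e).trans ?_)
  simp only [ite_mul, one_mul, zero_mul]

theorem length_superlevel_stepFun (n : ℕ) (a : E × ℕ → ℝ) (t : ℝ) :
    G.length (G.superlevel (G.stepFun n a) t) =
      ENNReal.ofReal (∑ p ∈ cells E n with t < a p, G.mesh n p.1) := by
  rw [length_eq_ofReal_sum_integral_char (isMeasurable_superlevel_stepFun n a t),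
    sum_integral_char_superlevel_stepFun]

theorem sum_mesh (n : ℕ) : ∑ p ∈ cells E n, G.mesh n p.1 = G.totalLength := by
  rw [sum_cells, totalLength]
  refine Finset.sum_congr rfl fun e _ => ?_
  simp [add_one_mul_mesh]

theorem length_superlevel_stepFun_compl (n : ℕ) (a : E × ℕ → ℝ) (t : ℝ) :
    G.length (G.superlevel (G.stepFun n a) t)ᶜ =
      ENNReal.ofReal (∑ p ∈ cells E n with a p ≤ t, G.mesh n p.1) := by
  have hnonneg : ∀ s : Finset (E × ℕ), 0 ≤ ∑ p ∈ s, G.mesh n p.1 := fun s =>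
    Finset.sum_nonneg fun p _ => mesh_pos.le
  have hadd := length_add_length_compl (isMeasurable_superlevel_stepFun (G := G) n a t)
  have hsplit := Finset.sum_filter_add_sum_filter_not (cells E n) (t < a ·) fun p => G.mesh n p.1
  simp only [not_lt] at hsplit
  rw [length_superlevel_stepFun, ← sum_mesh n, ← hsplit, ENNReal.ofReal_add (hnonneg _) (hnonneg _)]
    at hadd
  exact (ENNReal.add_right_inj ENNReal.ofReal_ne_top).1 hadd

theorem Per_superlevel_stepFun_le {a : E × ℕ → ℝ} {t M : ℝ}
    (hM : ∀ ζ, G.IsDiscreteField n ζ → ∑ p ∈ cells E n with t < a p, increment ζ p ≤ M) :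
    G.Per (G.superlevel (G.stepFun n a) t) ≤ ENNReal.ofReal M := by
  have hstep : G.Per (G.superlevel (G.stepFun n a) t) =
      G.TV (G.stepFun n fun p => if t < a p then 1 else 0) :=
    TV_congr fun e x hx => char_superlevel _ _ hx
  rw [hstep]
  refine TV_stepFun_le fun ζ hζ => (hM ζ hζ).trans_eq' ?_
  simp only [mul_ite, mul_one, mul_zero, Finset.sum_filter]

end DiscreteField

section Approximation

variable {G} {n : ℕ} {e : E} {u v w : G.Fun}

theorem integrableOn_cell {f : ℝ → ℝ} (hf : IntegrableOn f (Ioo 0 (G.len e))) {k : ℕ}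
    (hk : k < n + 1) : IntegrableOn f (G.cell n (e, k)) := by
  rw [← integrableOn_Ioc_iff_integrableOn_Ioo] at hf
  exact hf.mono_set (cell_subset hk)

theorem abs_cellMean_mul_mesh_le (n : ℕ) (u : G.Fun) (p : E × ℕ) :
    |G.cellMean n u p| * G.mesh n p.1 ≤ ∫ x in G.cell n p, |u p.1 x| := by
  rw [cellMean_eq, ← abs_of_pos (mesh_pos (G := G)), ← abs_mul, abs_of_pos mesh_pos, mul_comm,
    mul_inv_cancel_left₀ mesh_pos.ne']
  exact abs_integral_le_integral_abs

theorem integral_abs_stepFun_cellMean_le (n : ℕ) (hu : IntegrableOn (u e) (Ioo 0 (G.len e))) :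
    ∫ x in Ioo 0 (G.len e), |G.stepFun n (G.cellMean n u) e x| ≤
      ∫ x in Ioo 0 (G.len e), |u e x| := by
  rw [integral_eq_sum_cell (n := n) hu.abs]
  refine (integral_stepFun n (fun p => |G.cellMean n u p|) e).trans_le ?_
  exact Finset.sum_le_sum fun k _ => abs_cellMean_mul_mesh_le n u (e, k)

theorem stepFun_cellMean_sub (n : ℕ) (hu : IntegrableOn (u e) (Ioo 0 (G.len e)))
    (hv : IntegrableOn (v e) (Ioo 0 (G.len e))) (hw : ∀ x, w e x = u e x - v e x) {x : ℝ}
    (hx : x ∈ Ioo 0 (G.len e)) :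
    G.stepFun n (G.cellMean n w) e x =
      G.stepFun n (G.cellMean n u) e x - G.stepFun n (G.cellMean n v) e x := by
  obtain ⟨k, hk, hxk⟩ := exists_mem_cell n hx
  simp only [stepFun_of_mem_cell _ hxk, cellMean_eq, hw]
  rw [integral_sub (integrableOn_cell hu hk) (integrableOn_cell hv hk), mul_sub]

theorem abs_sub_stepFun_cellMean_le (hu : IntegrableOn (u e) (Ioo 0 (G.len e))) {ε : ℝ}
    (hosc : ∀ x y, |x - y| ≤ G.mesh n e → |u e x - u e y| ≤ ε) {x : ℝ}
    (hx : x ∈ Ioo 0 (G.len e)) : |u e x - G.stepFun n (G.cellMean n u) e x| ≤ ε := by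
  obtain ⟨k, hk, hxk⟩ := exists_mem_cell n hx
  have hmean : G.cellMean n u (e, k) ∈ Metric.closedBall (u e x) ε := by
    refine (convex_closedBall _ _).set_average_mem Metric.isClosed_closedBall ?_ ?_
      ((ae_restrict_mem measurableSet_Ioc).mono fun y hy => hosc y x ?_) (integrableOn_cell hu hk)
    · simp [cell, mesh_pos]
    · simp [cell]
    · rw [abs_le]
      constructor <;> linarith [hxk.1, hxk.2, hy.1, hy.2]
  rw [stepFun_of_mem_cell _ hxk, abs_sub_comm]
  exact hmean

theorem integral_abs_sub_stepFun_cellMean_le (hu : IntegrableOn (u e) (Ioo 0 (G.len e)))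
    (hv : IntegrableOn (v e) (Ioo 0 (G.len e))) {ε : ℝ}
    (hosc : ∀ x y, |x - y| ≤ G.mesh n e → |v e x - v e y| ≤ ε) :
    ∫ x in Ioo 0 (G.len e), |u e x - G.stepFun n (G.cellMean n u) e x| ≤
      2 * (∫ x in Ioo 0 (G.len e), |u e x - v e x|) + ε * G.len e := by
  obtain ⟨w, hw⟩ : ∃ w : G.Fun, ∀ x, w e x = u e x - v e x :=
    ⟨fun e x => u e x - v e x, fun _ => rfl⟩
  have hwi : IntegrableOn (w e) (Ioo 0 (G.len e)) := (funext hw : w e = _) ▸ hu.sub hv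
  have hstep := fun f : G.Fun => integrableOn_stepFun (G := G) n (G.cellMean n f) e
  have hadd : IntegrableOn (fun x => |w e x| + |G.stepFun n (G.cellMean n w) e x|)
    (Ioo 0 (G.len e)) := hwi.abs.add (hstep w).abs
  have hpt : ∀ x ∈ Ioo 0 (G.len e), |u e x - G.stepFun n (G.cellMean n u) e x| ≤
      |w e x| + |G.stepFun n (G.cellMean n w) e x| + ε := fun x hx => by
    calc |u e x - G.stepFun n (G.cellMean n u) e x|
        = |w e x - G.stepFun n (G.cellMean n w) e x +
            (v e x - G.stepFun n (G.cellMean n v) e x)| := by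
          rw [stepFun_cellMean_sub n hu hv hw hx, hw]
          congr 1
          ring
      _ ≤ _ := (abs_add_le _ _).trans
          (add_le_add (abs_sub _ _) (abs_sub_stepFun_cellMean_le hv hosc hx))
  simp only [← hw]
  calc ∫ x in Ioo 0 (G.len e), |u e x - G.stepFun n (G.cellMean n u) e x|
      ≤ ∫ x in Ioo 0 (G.len e), (|w e x| + |G.stepFun n (G.cellMean n w) e x| + ε) :=
        setIntegral_mono_on (hu.sub (hstep u)).abs (hadd.add (integrableOn_const (by simp)))
          measurableSet_Ioo hpt
    _ = (∫ x in Ioo 0 (G.len e), |w e x|) +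
          (∫ x in Ioo 0 (G.len e), |G.stepFun n (G.cellMean n w) e x|) + ε * G.len e := by
        rw [integral_add hadd (integrableOn_const (by simp)),
          integral_add hwi.abs (hstep w).abs, setIntegral_const, smul_eq_mul, mul_comm ε]
        simp [(G.len_pos e).le]
    _ ≤ _ := by linarith [integral_abs_stepFun_cellMean_le n hwi]

theorem tendsto_mesh (G : MetricGraph V E) (e : E) :
    Filter.Tendsto (fun n => G.mesh n e) Filter.atTop (nhds 0) := by
  simpa [mesh, div_eq_mul_inv] using
    (tendsto_one_div_add_atTop_nhds_zero_nat (𝕜 := ℝ)).const_mul (G.len e)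

theorem tendsto_integral_abs_sub_stepFun_cellMean
    (hu : IntegrableOn (u e) (Ioo 0 (G.len e))) :
    Filter.Tendsto (fun n => ∫ x in Ioo 0 (G.len e), |u e x - G.stepFun n (G.cellMean n u) e x|)
      Filter.atTop (nhds 0) := by
  refine Metric.tendsto_nhds.2 fun ε hε => ?_
  obtain ⟨g, hg, hgi, hug⟩ := exists_uniformContinuous_integral_abs_sub_le measurableSet_Ioo hu
    (ε := ε / 5) (by positivity)
  obtain ⟨η, hη, hosc⟩ := Metric.uniformContinuous_iff.1 hg (ε / (2 * G.len e))
    (div_pos hε (mul_pos two_pos (G.len_pos e)))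
  filter_upwards [(tendsto_mesh G e).eventually (gt_mem_nhds hη)] with n hn
  have hle := integral_abs_sub_stepFun_cellMean_le (n := n) (v := fun _ => g) hu hgi.integrableOn
    fun x y hxy => (hosc (hxy.trans_lt hn)).le
  have hlen : ε / (2 * G.len e) * G.len e = ε / 2 := by field_simp [(G.len_pos e).ne']
  rw [Real.dist_0_eq_abs, abs_of_nonneg (integral_nonneg fun x => abs_nonneg _)]
  linarith

end Approximation

section CheegerInequality

variable {G} {n : ℕ} {u : G.Fun}

theorem isMeasurable_superlevel (hu : ∀ e, IntegrableOn (u e) (Ioo 0 (G.len e))) (t : ℝ) :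
    G.IsMeasurable (G.superlevel u t) := fun e => by
  have hind := (aemeasurable_indicator_iff measurableSet_Ioo).2 (hu e).aemeasurable
  have hset : {x | x ∈ Ioo 0 (G.len e) ∧ t < u e x} =
      Ioo 0 (G.len e) ∩ {x | t < (Ioo 0 (G.len e)).indicator (u e) x} :=
    ext fun x => and_congr_right fun hx => iff_of_eq (congrArg (t < ·) (indicator_of_mem hx _).symm)
  rw [coordSet_superlevel, hset]
  exact measurableSet_Ioo.nullMeasurableSet.inter (nullMeasurableSet_lt aemeasurable_const hind)

variable [Fintype E]

theorem length_ne_top (A : Set G.Point) : G.length A ≠ ⊤ :=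
  ENNReal.sum_ne_top.2 fun e _ => measure_ne_top_of_subset (coordSet_subset A e) (by simp)

theorem cheeger_mul_min_le_Per {D : Set G.Point} (hD : G.IsMeasurable D) :
    G.cheeger * min (G.length D) (G.length Dᶜ) ≤ G.Per D := by
  rcases eq_or_ne (G.length D) 0 with h0 | h0
  · simp [h0]
  rcases eq_or_ne (G.length Dᶜ) 0 with h1 | h1
  · simp [h1]
  have hlt : G.length D < ENNReal.ofReal G.totalLength := by
    rw [← length_add_length_compl hD]
    exact ENNReal.lt_add_right (length_ne_top D) h1
  have hle : G.cheeger ≤ G.Per D / min (G.length D) (G.length Dᶜ) :=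
    iInf_le_of_le D <| iInf_le_of_le hD <| iInf_le_of_le (pos_iff_ne_zero.2 h0) <|
      iInf_le_of_le hlt le_rfl
  exact (ENNReal.le_div_iff_mul_le (.inl (by simp [h0, h1]))
    (.inl (ne_top_of_le_ne_top (length_ne_top D) (min_le_left _ _)))).1 hle

theorem Per_superlevel_stepFun_ne_top (n : ℕ) (a : E × ℕ → ℝ) (t : ℝ) :
    G.Per (G.superlevel (G.stepFun n a) t) ≠ ⊤ := by
  obtain ⟨ζ, -, hmax⟩ := exists_isDiscreteField_maximal G n a
  exact ne_top_of_le_ne_top ENNReal.ofReal_ne_top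
    (Per_superlevel_stepFun_le fun ζ' hζ' => hmax ζ' hζ' t)

theorem cheeger_ne_top [Nonempty E] : G.cheeger ≠ ⊤ := by
  classical
  obtain ⟨e₀⟩ := ‹Nonempty E›
  let a : E × ℕ → ℝ := Pi.single (e₀, 0) 1
  have hpos : ∀ (s : Finset (E × ℕ)) (p : E × ℕ), p ∈ s →
      0 < ENNReal.ofReal (∑ p ∈ s, G.mesh 1 p.1) := fun s p hp =>
    ENNReal.ofReal_pos.2 (Finset.sum_pos (fun p _ => mesh_pos) ⟨p, hp⟩)
  have hD : 0 < G.length (G.superlevel (G.stepFun 1 a) 0) := by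
    rw [length_superlevel_stepFun]
    exact hpos _ (e₀, 0) (by simp [a, cells])
  have hDc : 0 < G.length (G.superlevel (G.stepFun 1 a) 0)ᶜ := by
    rw [length_superlevel_stepFun_compl]
    exact hpos _ (e₀, 1) (by simp [a, cells])
  intro htop
  have hle := cheeger_mul_min_le_Per (isMeasurable_superlevel_stepFun (G := G) 1 a 0)
  rw [htop, ENNReal.top_mul (lt_min hD hDc).ne'] at hle
  exact Per_superlevel_stepFun_ne_top 1 a 0 (top_le_iff.1 hle)

theorem IsDiscreteField.sum_filter_increment_nonneg {ζ : E → ℕ → ℝ} (hζ : G.IsDiscreteField n ζ)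
    {s : Finset (E × ℕ)} (hmax : ∀ ζ', G.IsDiscreteField n ζ' →
      ∑ p ∈ s, increment ζ' p ≤ ∑ p ∈ s, increment ζ p) : 0 ≤ ∑ p ∈ s, increment ζ p := by
  have hneg : ∑ p ∈ s, increment (fun e k => -ζ e k) p = -∑ p ∈ s, increment ζ p := by
    rw [← Finset.sum_neg_distrib]
    exact Finset.sum_congr rfl fun p _ => by simp only [increment]; ring
  linarith [hmax _ hζ.neg]

theorem exists_cheeger_mul_sum_mesh_mul_abs_sub_le_TV [Nonempty E] (n : ℕ)
    (hu : ∀ e, IntegrableOn (u e) (Ioo 0 (G.len e))) :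
    ∃ c, ENNReal.ofReal (G.cheeger.toReal *
      ∑ p ∈ cells E n, G.mesh n p.1 * |G.cellMean n u p - c|) ≤ G.TV u := by
  obtain ⟨ζ, hζ, hmax⟩ := exists_isDiscreteField_maximal G n (G.cellMean n u)
  have hflux : ∀ t, G.cheeger.toReal *
      min (∑ p ∈ cells E n with t < G.cellMean n u p, G.mesh n p.1)
        (∑ p ∈ cells E n with G.cellMean n u p ≤ t, G.mesh n p.1) ≤
      ∑ p ∈ cells E n with t < G.cellMean n u p, increment ζ p := fun t => by
    refine (ENNReal.ofReal_le_ofReal_iff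
      (hζ.sum_filter_increment_nonneg fun ζ' hζ' => hmax ζ' hζ' t)).1 ?_
    rw [ENNReal.ofReal_mul ENNReal.toReal_nonneg, ENNReal.ofReal_toReal cheeger_ne_top,
      ENNReal.ofReal_min, ← length_superlevel_stepFun, ← length_superlevel_stepFun_compl]
    exact (cheeger_mul_min_le_Per (isMeasurable_superlevel_stepFun n _ t)).trans
      (Per_superlevel_stepFun_le fun ζ' hζ' => hmax ζ' hζ' t)
  obtain ⟨c, hc⟩ := exists_mul_sum_abs_sub_le (fun p _ => mesh_pos.le) hζ.sum_increment hflux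
  exact ⟨c, (ENNReal.ofReal_le_ofReal hc).trans (ofReal_sum_increment_mul_cellMean_le_TV hu hζ)⟩

theorem sum_integral_abs_stepFun_sub (n : ℕ) (a : E × ℕ → ℝ) (c : ℝ) :
    ∑ e, ∫ x in Ioo 0 (G.len e), |G.stepFun n a e x - c| =
      ∑ p ∈ cells E n, G.mesh n p.1 * |a p - c| := by
  rw [sum_cells]
  refine Finset.sum_congr rfl fun e _ => (integral_stepFun n (fun p => |a p - c|) e).trans ?_
  exact Finset.sum_congr rfl fun k _ => mul_comm _ _

theorem normL1_eq_ofReal (hu : ∀ e, IntegrableOn (u e) (Ioo 0 (G.len e))) :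
    G.normL1 u = ENNReal.ofReal (∑ e, ∫ x in Ioo 0 (G.len e), |u e x|) := by
  refine Eq.trans (Finset.sum_congr rfl fun e _ => ?_)
    (ENNReal.ofReal_sum_of_nonneg fun e _ => integral_nonneg fun x => abs_nonneg _).symm
  rw [eLpNorm_one_eq_lintegral_enorm, ← ofReal_integral_norm_eq_lintegral_enorm (hu e)]
  rfl

theorem totalLength_nonneg (G : MetricGraph V E) : 0 ≤ G.totalLength :=
  Finset.sum_nonneg fun e _ => (G.len_pos e).le

theorem sum_integral_char_superlevel_le (hu : ∀ e, IntegrableOn (u e) (Ioo 0 (G.len e))) {t : ℝ}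
    (h : G.length (G.superlevel u t) ≤ ENNReal.ofReal (G.totalLength / 2)) :
    ∑ e, ∫ x in Ioo 0 (G.len e), G.char (G.superlevel u t) e x ≤ G.totalLength / 2 := by
  rwa [length_eq_ofReal_sum_integral_char (isMeasurable_superlevel hu t),
    ENNReal.ofReal_le_ofReal_iff (by linarith [totalLength_nonneg G])] at h

theorem sum_integral_abs_le_of_length_superlevel_le
    (hu : ∀ e, IntegrableOn (u e) (Ioo 0 (G.len e)))
    (h : G.length (G.superlevel u 0) ≤ ENNReal.ofReal (G.totalLength / 2)) {c : ℝ} (hc : 0 ≤ c) :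
    ∑ e, ∫ x in Ioo 0 (G.len e), |u e x| ≤ ∑ e, ∫ x in Ioo 0 (G.len e), |u e x - c| := by
  have hconst : ∀ e, IntegrableOn (fun _ : ℝ => c) (Ioo 0 (G.len e)) := fun e =>
    integrableOn_const (by simp)
  have hchar := fun e => (integrableOn_char (isMeasurable_superlevel hu 0) e).const_mul (2 * c)
  have hsub : ∀ e, IntegrableOn (fun x => |u e x - c|) (Ioo 0 (G.len e)) := fun e =>
    ((hu e).sub (hconst e)).abs
  have hpt : ∀ e, ∀ x ∈ Ioo 0 (G.len e),
      |u e x| + c ≤ |u e x - c| + 2 * c * G.char (G.superlevel u 0) e x := fun e x hx => by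
    rw [char_superlevel u 0 hx]
    split_ifs with h0
    · rw [abs_of_pos h0]
      linarith [le_abs_self (u e x - c)]
    · rw [abs_of_nonpos (not_lt.1 h0)]
      linarith [neg_le_abs (u e x - c)]
  have hedge : ∀ e, (∫ x in Ioo 0 (G.len e), |u e x|) + c * G.len e ≤
      (∫ x in Ioo 0 (G.len e), |u e x - c|) +
        2 * c * ∫ x in Ioo 0 (G.len e), G.char (G.superlevel u 0) e x := fun e => by
    have hmono := setIntegral_mono_on ((hu e).abs.add (hconst e)) ((hsub e).add (hchar e))
      measurableSet_Ioo (hpt e)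
    simp only [Pi.add_apply] at hmono
    rw [integral_add (hu e).abs (hconst e), integral_add (hsub e) (hchar e), integral_const_mul]
      at hmono
    simpa [(G.len_pos e).le, mul_comm] using hmono
  have hsum := Finset.sum_le_sum fun e (_ : e ∈ Finset.univ) => hedge e
  rw [Finset.sum_add_distrib, Finset.sum_add_distrib, ← Finset.mul_sum, ← Finset.mul_sum,
    ← totalLength] at hsum
  nlinarith [sum_integral_char_superlevel_le hu h]

theorem IsMedian.sum_integral_abs_le (h : G.IsMedian u 0)
    (hu : ∀ e, IntegrableOn (u e) (Ioo 0 (G.len e))) (c : ℝ) :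
    ∑ e, ∫ x in Ioo 0 (G.len e), |u e x| ≤ ∑ e, ∫ x in Ioo 0 (G.len e), |u e x - c| := by
  rcases le_total 0 c with hc | hc
  · exact sum_integral_abs_le_of_length_superlevel_le hu h.2 hc
  · let v : G.Fun := fun e x => -u e x
    have hv : G.superlevel v 0 = G.sublevel u 0 := by
      simp only [superlevel, sublevel, v, neg_pos]
    have hle := sum_integral_abs_le_of_length_superlevel_le (u := v) (fun e => (hu e).neg)
      (by rw [hv]; exact h.1) (neg_nonneg.2 hc)
    have habs : ∀ e x, |v e x - -c| = |u e x - c| := fun e x => by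
      rw [← abs_neg (u e x - c), neg_sub, sub_neg_eq_add, neg_add_eq_sub]
    simpa only [v, abs_neg, habs] using hle

theorem sum_integral_abs_sub_le_add {v : G.Fun} (hu : ∀ e, IntegrableOn (u e) (Ioo 0 (G.len e)))
    (hv : ∀ e, IntegrableOn (v e) (Ioo 0 (G.len e))) (c : ℝ) :
    ∑ e, ∫ x in Ioo 0 (G.len e), |u e x - c| ≤
      (∑ e, ∫ x in Ioo 0 (G.len e), |u e x - v e x|) +
        ∑ e, ∫ x in Ioo 0 (G.len e), |v e x - c| := by
  refine (Finset.sum_le_sum fun e _ => ?_).trans_eq Finset.sum_add_distrib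
  have hconst : IntegrableOn (fun _ : ℝ => c) (Ioo 0 (G.len e)) := integrableOn_const (by simp)
  have huv := ((hu e).sub (hv e)).abs
  have hvc := ((hv e).sub hconst).abs
  refine (integral_mono ((hu e).sub hconst).abs (huv.add hvc) fun x => ?_).trans_eq
    (integral_add huv hvc)
  exact abs_sub_le _ _ _

theorem cheeger_le_TV [Nonempty E] (hu : u ∈ G.admissible) : G.cheeger ≤ G.TV u := by
  obtain ⟨hbv, hnorm, hmed⟩ := hu
  have hi : ∀ e, IntegrableOn (u e) (Ioo 0 (G.len e)) := fun e => (hbv e).1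
  rcases eq_or_ne (G.TV u) ⊤ with htop | htop
  · exact htop ▸ le_top
  let S : ℕ → G.Fun := fun n => G.stepFun n (G.cellMean n u)
  have hone : ∑ e, ∫ x in Ioo 0 (G.len e), |u e x| = 1 :=
    ENNReal.ofReal_eq_one.1 ((normL1_eq_ofReal hi).symm.trans hnorm)
  have hS : Filter.Tendsto (fun n => ∑ e, ∫ x in Ioo 0 (G.len e), |u e x - S n e x|)
      Filter.atTop (nhds 0) := by
    simpa using tendsto_finsetSum Finset.univ
      fun e _ => tendsto_integral_abs_sub_stepFun_cellMean (hi e)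
  have hle : ∀ n, G.cheeger.toReal * (1 - ∑ e, ∫ x in Ioo 0 (G.len e), |u e x - S n e x|) ≤
      (G.TV u).toReal := fun n => by
    obtain ⟨c, hc⟩ := exists_cheeger_mul_sum_mesh_mul_abs_sub_le_TV n hi
    rw [← sum_integral_abs_stepFun_sub] at hc
    refine le_trans (mul_le_mul_of_nonneg_left ?_ ENNReal.toReal_nonneg)
      ((ENNReal.ofReal_le_iff_le_toReal htop).1 hc)
    rw [sub_le_iff_le_add']
    exact (hone.symm.le.trans (hmed.sum_integral_abs_le hi c)).trans
      (sum_integral_abs_sub_le_add hi (fun e => integrableOn_stepFun n _ e) c)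
  have hlim := (hS.const_sub 1).const_mul G.cheeger.toReal
  rw [sub_zero, mul_one] at hlim
  exact (ENNReal.toReal_le_toReal cheeger_ne_top htop).1 (le_of_tendsto' hlim hle)

end CheegerInequality

section CharacteristicFunctions

variable {G} {A D : Set G.Point}

theorem integrableOn_char_mul (hA : G.IsMeasurable A) {e : E} {f : ℝ → ℝ}
    (hf : IntegrableOn f (Ioo 0 (G.len e))) :
    IntegrableOn (fun x => G.char A e x * f x) (Ioo 0 (G.len e)) :=
  hf.bdd_mul (c := 1) (integrableOn_char hA e).aestronglyMeasurable
    (.of_forall fun x => (norm_indicator_le_norm_self _ _).trans (by simp))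

variable [Fintype E] {u : G.Fun}

theorem TV_eq_ofReal_abs_mul_Per (hA : G.IsMeasurable A) {a b : ℝ}
    (hu : ∀ e, ∀ x ∈ Ioo 0 (G.len e), u e x = a + b * G.char A e x) :
    G.TV u = ENNReal.ofReal |b| * G.Per A := by
  refine TV_eq_ofReal_abs_mul_TV fun z z' hz => ?_
  have hedge : ∀ e, ∫ x in Ioo 0 (G.len e), u e x * z' e x =
      a * (∫ x in Ioo 0 (G.len e), z' e x) +
        b * ∫ x in Ioo 0 (G.len e), G.char A e x * z' e x := fun e => by
    rw [← integral_const_mul, ← integral_const_mul, ← integral_add ((hz.integrableOn e).const_mul a)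
      ((integrableOn_char_mul hA (hz.integrableOn e)).const_mul b)]
    exact setIntegral_congr_fun measurableSet_Ioo fun x hx => by
      simp only [hu e x hx]
      ring
  rw [Finset.sum_congr rfl fun e _ => hedge e, Finset.sum_add_distrib, ← Finset.mul_sum,
    ← Finset.mul_sum, hz.sum_integral_eq_zero, mul_zero, zero_add]

theorem Per_compl (hA : G.IsMeasurable A) : G.Per Aᶜ = G.Per A := by
  refine (TV_eq_ofReal_abs_mul_Per hA (a := 1) (b := -1) fun e x hx => ?_).trans (by simp)
  rw [char_compl A (Ioo_subset_Icc_self hx), neg_one_mul, sub_eq_add_neg]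

theorem length_superlevel_le {t : ℝ}
    (h : ∀ e, ∀ x ∈ Ioo 0 (G.len e), t < u e x → x ∈ G.coordSet A e) :
    G.length (G.superlevel u t) ≤ G.length A := by
  refine Finset.sum_le_sum fun e _ => measure_mono ?_
  rw [coordSet_superlevel]
  exact fun x hx => h e x hx.1 hx.2

theorem length_sublevel_le {t : ℝ}
    (h : ∀ e, ∀ x ∈ Ioo 0 (G.len e), u e x < t → x ∈ G.coordSet A e) :
    G.length (G.sublevel u t) ≤ G.length A := by
  refine Finset.sum_le_sum fun e _ => measure_mono ?_
  rw [coordSet_sublevel]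
  exact fun x hx => h e x hx.1 hx.2

/-- The characteristic function of a set, divided by the length of the set: the competitor in the
variational problem for `λ₁(Γ)` that is associated with the set. -/
noncomputable def normalizedChar (G : MetricGraph V E) (D : Set G.Point) : G.Fun :=
  fun e x => (G.length D).toReal⁻¹ * G.char D e x

theorem TV_normalizedChar (hD : G.IsMeasurable D) (h0 : G.length D ≠ 0) :
    G.TV (G.normalizedChar D) = G.Per D / G.length D := by
  have hpos := ENNReal.toReal_pos h0 (length_ne_top D)
  have hmul : ∀ e, ∀ x ∈ Ioo 0 (G.len e),
      G.normalizedChar D e x = 0 + (G.length D).toReal⁻¹ * G.char D e x := fun e x _ =>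
    (zero_add _).symm
  rw [TV_eq_ofReal_abs_mul_Per hD hmul, abs_of_pos (inv_pos.2 hpos),
    ENNReal.ofReal_inv_of_pos hpos, ENNReal.ofReal_toReal (length_ne_top D),
    ← ENNReal.div_eq_inv_mul]

theorem integrableOn_normalizedChar (hD : G.IsMeasurable D) (e : E) :
    IntegrableOn (G.normalizedChar D e) (Ioo 0 (G.len e)) :=
  (integrableOn_char hD e).const_mul _

theorem normalizedChar_nonneg (D : Set G.Point) (e : E) (x : ℝ) : 0 ≤ G.normalizedChar D e x :=
  mul_nonneg (inv_nonneg.2 ENNReal.toReal_nonneg) (char_nonneg D e x)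

theorem normL1_normalizedChar (hD : G.IsMeasurable D) (h0 : G.length D ≠ 0) :
    G.normL1 (G.normalizedChar D) = 1 := by
  have hchar : ∑ e, ∫ x in Ioo 0 (G.len e), G.char D e x = (G.length D).toReal := by
    rw [length_eq_ofReal_sum_integral_char hD, ENNReal.toReal_ofReal]
    exact Finset.sum_nonneg fun e _ => integral_nonneg (char_nonneg D e)
  have hedge : ∀ e, ∫ x in Ioo 0 (G.len e), |G.normalizedChar D e x| =
      (G.length D).toReal⁻¹ * ∫ x in Ioo 0 (G.len e), G.char D e x := fun e => by
    rw [← integral_const_mul]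
    exact congrArg (integral _) (funext fun x => abs_of_nonneg (normalizedChar_nonneg D e x))
  rw [normL1_eq_ofReal (integrableOn_normalizedChar hD),
    Finset.sum_congr rfl fun e _ => hedge e, ← Finset.mul_sum, hchar,
    inv_mul_cancel₀ (ENNReal.toReal_pos h0 (length_ne_top D)).ne', ENNReal.ofReal_one]

theorem isMedian_normalizedChar (h : G.length D ≤ ENNReal.ofReal (G.totalLength / 2)) :
    G.IsMedian (G.normalizedChar D) 0 := by
  refine ⟨(length_sublevel_le (A := ∅) fun e x _ hlt => ?_).trans (by simp [length, coordSet]),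
    (length_superlevel_le fun e x _ hlt => ?_).trans h⟩
  · exact absurd hlt (normalizedChar_nonneg D e x).not_gt
  · by_contra hx
    simp [normalizedChar, char_of_notMem hx] at hlt

theorem lambda1_le_Per_div_length (hD : G.IsMeasurable D) (h0 : G.length D ≠ 0)
    (h : G.length D ≤ ENNReal.ofReal (G.totalLength / 2)) :
    G.lambda1 ≤ G.Per D / G.length D := by
  rw [← TV_normalizedChar hD h0]
  rcases eq_or_ne (G.TV (G.normalizedChar D)) ⊤ with htop | htop
  · exact htop ▸ le_top
  · exact iInf₂_le _ ⟨memBV_of_TV_ne_top (integrableOn_normalizedChar hD) htop,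
      normL1_normalizedChar hD h0, isMedian_normalizedChar h⟩

theorem ofReal_totalLength (G : MetricGraph V E) : ENNReal.ofReal G.totalLength =
    ENNReal.ofReal (G.totalLength / 2) + ENNReal.ofReal (G.totalLength / 2) := by
  have hhalf := div_nonneg (totalLength_nonneg G) zero_le_two
  rw [← ENNReal.ofReal_add hhalf hhalf, add_halves]

theorem min_length_le_half (hD : G.IsMeasurable D) :
    min (G.length D) (G.length Dᶜ) ≤ ENNReal.ofReal (G.totalLength / 2) := by
  by_contra! hlt
  have hadd := ENNReal.add_lt_add (lt_min_iff.1 hlt).1 (lt_min_iff.1 hlt).2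
  rw [← ofReal_totalLength, length_add_length_compl hD] at hadd
  exact lt_irrefl _ hadd

theorem lambda1_le_cheeger (G : MetricGraph V E) : G.lambda1 ≤ G.cheeger := by
  refine le_iInf fun D => le_iInf fun hD => le_iInf fun h0 => le_iInf fun hlt => ?_
  have h1 : G.length Dᶜ ≠ 0 := fun h1 => by
    rw [← length_add_length_compl hD, h1, add_zero] at hlt
    exact lt_irrefl _ hlt
  have hhalf := min_length_le_half hD
  rcases le_total (G.length D) (G.length Dᶜ) with hle | hle
  · rw [min_eq_left hle] at hhalf ⊢
    exact lambda1_le_Per_div_length hD h0.ne' hhalf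
  · rw [min_eq_right hle] at hhalf ⊢
    exact Per_compl hD ▸ lambda1_le_Per_div_length hD.compl h1 hhalf

theorem lambda1_eq_cheeger [Nonempty E] (G : MetricGraph V E) : G.lambda1 = G.cheeger :=
  (lambda1_le_cheeger G).antisymm (le_iInf₂ fun _ hu => cheeger_le_TV hu)

theorem cutFun_eq (A : Set G.Point) {e : E} {x : ℝ} (hx : x ∈ Ioo 0 (G.len e)) :
    G.cutFun A e x = -(1 / G.totalLength) + 2 / G.totalLength * G.char A e x := by
  rw [cutFun, char_compl A (Ioo_subset_Icc_self hx)]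
  ring

theorem integrableOn_cutFun (hA : G.IsMeasurable A) (e : E) :
    IntegrableOn (G.cutFun A e) (Ioo 0 (G.len e)) :=
  ((integrableOn_char hA e).sub (integrableOn_char hA.compl e)).const_mul _

theorem totalLength_pos [Nonempty E] (G : MetricGraph V E) : 0 < G.totalLength :=
  Finset.sum_pos (fun e _ => G.len_pos e) Finset.univ_nonempty

theorem TV_cutFun [Nonempty E] (hA : G.IsMeasurable A)
    (h : G.length A = ENNReal.ofReal (G.totalLength / 2)) :
    G.TV (G.cutFun A) = G.Per A / G.length A := by
  have hpos := totalLength_pos G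
  rw [TV_eq_ofReal_abs_mul_Per hA fun e x hx => cutFun_eq A hx, abs_of_pos (by positivity), h,
    ENNReal.div_eq_inv_mul, ← ENNReal.ofReal_inv_of_pos (by positivity), inv_div]

theorem normL1_cutFun [Nonempty E] (hA : G.IsMeasurable A) : G.normL1 (G.cutFun A) = 1 := by
  have hpos := totalLength_pos G
  have habs : ∀ e, ∀ x ∈ Ioo 0 (G.len e), |G.cutFun A e x| = 1 / G.totalLength :=
    fun e x hx => by
      rw [cutFun_eq A hx]
      by_cases hxA : x ∈ G.coordSet A e
      · rw [char_of_mem hxA, abs_of_pos] <;> ring_nf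
        positivity
      · rw [char_of_notMem hxA, mul_zero, add_zero, abs_neg, abs_of_pos (one_div_pos.2 hpos)]
  have hedge : ∀ e, ∫ x in Ioo 0 (G.len e), |G.cutFun A e x| = 1 / G.totalLength * G.len e :=
    fun e => (setIntegral_congr_fun measurableSet_Ioo (habs e)).trans
      (by simp [(G.len_pos e).le, mul_comm])
  rw [normL1_eq_ofReal (integrableOn_cutFun hA), Finset.sum_congr rfl fun e _ => hedge e,
    ← Finset.mul_sum, ← totalLength, one_div_mul_cancel hpos.ne', ENNReal.ofReal_one]

theorem isMedian_cutFun (hA : G.IsMeasurable A)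
    (h : G.length A = ENNReal.ofReal (G.totalLength / 2)) : G.IsMedian (G.cutFun A) 0 := by
  have hinv : 0 ≤ 1 / G.totalLength := one_div_nonneg.2 (totalLength_nonneg G)
  have hcompl : G.length Aᶜ = ENNReal.ofReal (G.totalLength / 2) := by
    rw [← ENNReal.add_right_inj (length_ne_top A), length_add_length_compl hA, h,
      ofReal_totalLength]
  refine ⟨(length_sublevel_le fun e x hx hlt => ?_).trans hcompl.le,
    (length_superlevel_le fun e x hx hlt => ?_).trans h.le⟩ <;> rw [cutFun_eq A hx] at hlt
  · refine ⟨Ioo_subset_Icc_self hx, fun hxA => hlt.not_ge ?_⟩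
    rw [char_of_mem ⟨Ioo_subset_Icc_self hx, hxA⟩]
    linarith [show 2 / G.totalLength = 2 * (1 / G.totalLength) by ring]
  · by_contra hxA
    rw [char_of_notMem hxA] at hlt
    linarith

theorem cutFun_mem_admissible [Nonempty E] (hA : G.IsMeasurable A)
    (h : G.length A = ENNReal.ofReal (G.totalLength / 2)) (hTV : G.TV (G.cutFun A) ≠ ⊤) :
    G.cutFun A ∈ G.admissible :=
  ⟨memBV_of_TV_ne_top (integrableOn_cutFun hA) hTV, normL1_cutFun hA, isMedian_cutFun hA h⟩

end CharacteristicFunctions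

end MetricGraph

theorem mainTheorem12 {V E : Type*} [Fintype V] [Fintype E] [Nonempty E] (G : MetricGraph V E)
    (A : Set G.Point) (hmeas : G.IsMeasurable A)
    (hA : G.length A = ENNReal.ofReal (G.totalLength / 2)) :
    G.cheeger = G.Per A / G.length A ↔ G.IsMinimizer (G.cutFun A) := by
  rw [← MetricGraph.TV_cutFun hmeas hA, MetricGraph.IsMinimizer, MetricGraph.lambda1_eq_cheeger]
  refine ⟨fun h => ⟨MetricGraph.cutFun_mem_admissible hmeas hA ?_, h.symm⟩, fun h => h.2.symm⟩
  exact h ▸ MetricGraph.cheeger_ne_top
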